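/- **Setting.** Let $G=(G_t)_{t\ge 0}$ be a real centered Gaussian process on a probability space, with continuous covariance function $R(t,s)=\mathbb E[G_tG_s]$, and let $R^B(t,s)=\frac12\big(s^{2H}+t^{2H}-|t-s|^{2H}\big)$ be the covariance function of fractional Brownian motion with Hurst parameter $H$. Assume that for some constant $C'_H\ge 0$ and every $T>0$: 1. $R(0,s)=0$ for all $s\ge 0$; 2. for every $s\in(0,T)$ the function $t\mapsto R(t,s)$ is continuous on $[0,T]$ and differentiable on $(0,s)\cup(s,T)$, and $\frac{\partial R}{\partial t}(\cdot,s)$ is integrable on $(0,T)$; 3. for every $t\in(0,T)$ the function $s\mapsto \frac{\partial R}{\partial t}(t,s)-\frac{\partial R^B}{\partial t}(t,s)$, $s\ne t$, extends to a continuous function on $[0,T]$ which is differentiable on $(0,T)$, with derivative $\Psi(t,s)$ satisfying $|\Psi(t,s)|\le C'_H|ts|^{H-1}$ for $s\in(0,T)$. For $T>0$ let $\mathfrak H$ be the Hilbert space obtained as the completion of the real step functions on $[0,T]$ for the inner product determined by $\langle \mathbf 1_{[a,b)},\mathbf 1_{[c,d)}\rangle_{\mathfrak H}=\mathbb E[(G_b-G_a)(G_d-G_c)]$,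 and let $\mathfrak H^{\otimes 2}$ be its Hilbert-space tensor square. For symmetric $f,g\in\mathfrak H^{\otimes2}$ and a complete orthonormal system $(e_i)$ of $\mathfrak H$, the first contraction is $f\otimes_1 g=\sum_i\langle f,e_i\rangle_{\mathfrak H}\otimes\langle g,e_i\rangle_{\mathfrak H}\in\mathfrak H^{\otimes 2}$, where $\langle f,e_i\rangle_{\mathfrak H}\in\mathfrak H$ is the partial inner product in one variable. Let $\theta>0$ and $f_T(t,s)=e^{-\theta|t-s|}\mathbf 1_{\{0\le s,t\le T\}}$, regarded as an element of $\mathfrak H^{\otimes2}$, namely as the limit in $\mathfrak H^{\otimes 2}$ of the step functions $\sum_{i,j<n} f_T(t_i,t_j)\,\mathbf 1_{[t_i,t_{i+1})}\otimes\mathbf 1_{[t_j,t_{j+1})}$ along partitions $0=t_0\le\dots\le t_n=T$ whose mesh tends to $0$ (part of the claim is that this limit exists). **Proposition 4.1.** Let $H\in(0,\frac38)$ and put $\delta=\frac12$ if $H\in(0,\frac14)$ and $\delta=\frac32-4H$ if $H\in(\frac14,\frac38)$. There is a constant $C>0$, depending only on $\theta$, $H$ and $C'_H$, such that for every such process $G$: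 * if $H\ne\frac14$, then $\displaystyle \frac1T\,\|f_T\otimes_1 f_T\|_{\mathfrak H^{\otimes 2}}\le \frac{C}{T^{\delta}}$ for all $T\ge 1$; * if $H=\frac14$, then $\displaystyle \frac1T\,\|f_T\otimes_1 f_T\|_{\mathfrak H^{\otimes 2}}\le C\,\frac{\log T}{\sqrt T}$ for all $T\ge 2$. -/

import Mathlib

open MeasureTheory ProbabilityTheory Filter Topology Set
open scoped NNReal TensorProduct

namespace GaussianOU

noncomputable section

/-! ### Centered Gaussian processes, covariances and the structural hypothesis -/

/-- A real-valued centered Gaussian process `(G_t)_{t ≥ 0}` on `(Ω, P)`. -/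
structure CenteredGaussianProcess {Ω : Type*} [MeasurableSpace Ω] (P : Measure Ω) where
  /-- the process -/
  toFun : ℝ≥0 → Ω → ℝ
  isGaussian : IsGaussianProcess toFun P
  centered : ∀ t, ∫ ω, toFun t ω ∂P = 0

variable {Ω : Type*} [MeasurableSpace Ω] {P : Measure Ω}

/-- The random variable `G_t`, as a function of a real time `t`
(only times `t ≥ 0` are meaningful). -/
def CenteredGaussianProcess.at (G : CenteredGaussianProcess P) (t : ℝ) : Ω → ℝ :=
  G.toFun t.toNNReal

/-- The covariance function `R(t, s) = E[G_t G_s]`. -/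
def CenteredGaussianProcess.cov (G : CenteredGaussianProcess P) (t s : ℝ) : ℝ :=
  ∫ ω, G.at t ω * G.at s ω ∂P

/-- The covariance function of fractional Brownian motion with Hurst parameter `H`. -/
def fbmCov (H t s : ℝ) : ℝ :=
  (1 / 2) * (s ^ (2 * H) + t ^ (2 * H) - |t - s| ^ (2 * H))

/-- The hypothesis on the covariance function `R` of the driving noise: `R` is continuous, vanishes
when one time is `0`, is regular in `t` off the diagonal, and the mixed derivative of
`R - R^B` is bounded by `C' (ts)^{H-1}`, with `C'` independent of the horizon `T`. -/
structure NoiseHypothesis (R : ℝ → ℝ → ℝ) (H C' : ℝ) : Prop where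
  continuous : ContinuousOn (Function.uncurry R) (Ici 0 ×ˢ Ici 0)
  zero_left : ∀ s, 0 ≤ s → R 0 s = 0
  continuousOn_left : ∀ T, ∀ s ∈ Ioo 0 T, ContinuousOn (fun t => R t s) (Icc 0 T)
  differentiableAt_left : ∀ T, ∀ s ∈ Ioo 0 T, ∀ t ∈ Ioo 0 s ∪ Ioo s T,
    DifferentiableAt ℝ (fun t => R t s) t
  integrable_deriv_left : ∀ T, ∀ s ∈ Ioo 0 T,
    IntegrableOn (deriv fun t => R t s) (Ioo 0 T)
  /-- For fixed `t`, the difference `s ↦ ∂R/∂t (t,s) - ∂R^B/∂t (t,s)` (defined for `s ≠ t`) extends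
  to a continuous function `D` on `[0,T]`, differentiable on `(0,T)`, with derivative
  `Ψ(t,s)` satisfying `|Ψ(t,s)| ≤ C' |ts|^{H-1}`. -/
  mixed_deriv_bound : ∀ T, ∀ t ∈ Ioo 0 T, ∃ D : ℝ → ℝ,
    (∀ s ∈ Icc 0 T, s ≠ t →
      D s = deriv (fun t' => R t' s) t - deriv (fun t' => fbmCov H t' s) t) ∧
    ContinuousOn D (Icc 0 T) ∧
    ∀ s ∈ Ioo 0 T, DifferentiableAt ℝ D s ∧ |deriv D s| ≤ C' * |t * s| ^ (H - 1)

/-! ### Step functions on `[0,T]` -/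

/-- The space of real step functions on `[0,T]`: the span of the indicators `1_{[a,b)}` with
`0 ≤ a` and `b ≤ T`. -/
def stepFunctions (T : ℝ) : Submodule ℝ (ℝ → ℝ) :=
  Submodule.span ℝ {f | ∃ a b : ℝ, 0 ≤ a ∧ b ≤ T ∧ f = (Ico a b).indicator 1}

/-- The drop `f(x-) - f(x)` of `f` at `x`. -/
def drop (f : ℝ → ℝ) (x : ℝ) : ℝ := Function.leftLim f x - f x

/-- `f` has left limits and only finitely many drops. -/
def IsTame (f : ℝ → ℝ) : Prop :=
  (∀ x, ∃ l, Tendsto f (𝓝[<] x) (𝓝 l)) ∧ (Function.support (drop f)).Finite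

lemma drop_add {f g : ℝ → ℝ} (hf : IsTame f) (hg : IsTame g) : drop (f + g) = drop f + drop g := by
  funext x
  obtain ⟨l, hl⟩ := hf.1 x
  obtain ⟨m, hm⟩ := hg.1 x
  have h : Tendsto (f + g) (𝓝[<] x) (𝓝 (l + m)) := hl.add hm
  simp only [drop, Pi.add_apply, leftLim_eq_of_tendsto hl, leftLim_eq_of_tendsto hm,
    leftLim_eq_of_tendsto h]
  ring

lemma drop_smul (c : ℝ) {f : ℝ → ℝ} (hf : IsTame f) : drop (c • f) = c • drop f := by
  funext x
  obtain ⟨l, hl⟩ := hf.1 x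
  have h : Tendsto (c • f) (𝓝[<] x) (𝓝 (c • l)) := hl.const_smul c
  simp only [drop, Pi.smul_apply, leftLim_eq_of_tendsto hl, leftLim_eq_of_tendsto h, smul_eq_mul]
  ring

lemma IsTame.add {f g : ℝ → ℝ} (hf : IsTame f) (hg : IsTame g) : IsTame (f + g) := by
  refine ⟨fun x => ?_, ?_⟩
  · obtain ⟨l, hl⟩ := hf.1 x
    obtain ⟨m, hm⟩ := hg.1 x
    exact ⟨l + m, hl.add hm⟩
  · rw [drop_add hf hg]
    exact (hf.2.union hg.2).subset (Function.support_add _ _)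

lemma IsTame.smul (c : ℝ) {f : ℝ → ℝ} (hf : IsTame f) : IsTame (c • f) := by
  refine ⟨fun x => ?_, ?_⟩
  · obtain ⟨l, hl⟩ := hf.1 x
    exact ⟨c • l, hl.const_smul c⟩
  · rw [drop_smul c hf]
    exact hf.2.subset (Function.support_const_smul_subset c _)

lemma tendsto_indicator_left (a b x : ℝ) :
    Tendsto ((Ico a b).indicator (1 : ℝ → ℝ)) (𝓝[<] x)
      (𝓝 ((Ioc a b).indicator (1 : ℝ → ℝ) x)) := by
  refine tendsto_const_nhds.congr' ?_
  rcases lt_or_ge a x with ha | ha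
  · rcases le_or_gt x b with hb | hb
    · filter_upwards [Ioo_mem_nhdsLT ha] with y hy
      rw [indicator_of_mem (show x ∈ Ioc a b from ⟨ha, hb⟩),
        indicator_of_mem (show y ∈ Ico a b from ⟨hy.1.le, hy.2.trans_le hb⟩)]
      rfl
    · filter_upwards [Ioo_mem_nhdsLT hb] with y hy
      rw [indicator_of_notMem (fun h => absurd h.2 (not_le.2 hb)),
        indicator_of_notMem (fun h => absurd h.2 (not_lt.2 hy.1.le))]
  · filter_upwards [self_mem_nhdsWithin] with y hy
    have hy : y < x := hy
    rw [indicator_of_notMem (fun h => absurd h.1 (not_lt.2 ha)),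
      indicator_of_notMem (fun h => absurd h.1 (not_le.2 (hy.trans_le ha)))]

lemma drop_indicator {a b : ℝ} (hab : a ≤ b) :
    drop ((Ico a b).indicator 1) = Pi.single b 1 - Pi.single a 1 := by
  funext x
  rw [drop, leftLim_eq_of_tendsto (tendsto_indicator_left a b x)]
  simp only [indicator_apply, mem_Ioc, mem_Ico, Pi.one_apply, Pi.sub_apply, Pi.single_apply]
  split_ifs <;> grind

lemma isTame_indicator (a b : ℝ) : IsTame ((Ico a b).indicator 1) := by
  refine ⟨fun x => ⟨_, tendsto_indicator_left a b x⟩, ?_⟩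
  rcases le_or_gt a b with hab | hab
  · rw [drop_indicator hab]
    refine (Set.toFinite {b, a}).subset fun x hx => ?_
    by_contra h
    simp only [mem_insert_iff, mem_singleton_iff, not_or] at h
    exact hx (by simp [h.1, h.2])
  · rw [Ico_eq_empty (not_lt.2 hab.le), indicator_empty]
    have : drop (fun _ : ℝ => (0 : ℝ)) = 0 := by
      funext x
      rw [drop, leftLim_eq_of_tendsto (tendsto_const_nhds (x := (0 : ℝ)) (f := 𝓝[<] x))]
      simp
    simp [this]

lemma isTame_of_mem {T : ℝ} {f : ℝ → ℝ} (hf : f ∈ stepFunctions T) : IsTame f := by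
  induction hf using Submodule.span_induction with
  | mem f h => obtain ⟨a, b, -, -, rfl⟩ := h; exact isTame_indicator a b
  | zero => simpa using (isTame_indicator 0 0).smul 0
  | add f g _ _ hf hg => exact hf.add hg
  | smul c f _ hf => exact hf.smul c

/-! ### The Hilbert space associated with the process on `[0,T]` -/

/-- The variable `G(f) = ∑_x (f(x-) - f(x)) G_x` attached to a step function `f`; it is the linear
map that sends `1_{[a,b)}` to `G_b - G_a`. -/
def CenteredGaussianProcess.stepIntegral (G : CenteredGaussianProcess P) (f : ℝ → ℝ) (ω : Ω) : ℝ :=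
  ∑ᶠ x, drop f x * G.at x ω

lemma CenteredGaussianProcess.finite_support (G : CenteredGaussianProcess P) {f : ℝ → ℝ}
    (hf : IsTame f) (ω : Ω) : (Function.support fun x => drop f x * G.at x ω).Finite :=
  hf.2.subset fun _ hx => left_ne_zero_of_mul hx

lemma CenteredGaussianProcess.stepIntegral_indicator (G : CenteredGaussianProcess P) {a b : ℝ}
    (hab : a ≤ b) (ω : Ω) :
    G.stepIntegral ((Ico a b).indicator 1) ω = G.at b ω - G.at a ω := by
  have h1 : ∀ c : ℝ, (fun x => Pi.single (M := fun _ => ℝ) c 1 x * G.at x ω).support ⊆ {c} := by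
    intro c x hx
    by_contra h
    exact hx (by simp [Pi.single_eq_of_ne (show x ≠ c from h)])
  have h2 : ∀ c : ℝ, ∑ᶠ x, Pi.single (M := fun _ => ℝ) c 1 x * G.at x ω = G.at c ω := by
    intro c
    rw [finsum_eq_single _ c (fun x hx => by simp [Pi.single_eq_of_ne hx])]
    simp
  simp only [CenteredGaussianProcess.stepIntegral, drop_indicator hab, Pi.sub_apply, sub_mul]
  rw [finsum_sub_distrib ((finite_singleton b).subset (h1 b))
    ((finite_singleton a).subset (h1 a)), h2, h2]

lemma CenteredGaussianProcess.stepIntegral_add (G : CenteredGaussianProcess P) {f g : ℝ → ℝ}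
    (hf : IsTame f) (hg : IsTame g) :
    G.stepIntegral (f + g) = G.stepIntegral f + G.stepIntegral g := by
  funext ω
  simp only [CenteredGaussianProcess.stepIntegral, drop_add hf hg, Pi.add_apply, add_mul]
  exact finsum_add_distrib (G.finite_support hf ω) (G.finite_support hg ω)

lemma CenteredGaussianProcess.stepIntegral_smul (G : CenteredGaussianProcess P) (c : ℝ)
    {f : ℝ → ℝ} (hf : IsTame f) : G.stepIntegral (c • f) = c • G.stepIntegral f := by
  funext ω
  simp only [CenteredGaussianProcess.stepIntegral, drop_smul c hf, Pi.smul_apply, smul_eq_mul,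
    mul_assoc]
  exact (mul_finsum (fun x => drop f x * G.at x ω) c).symm

lemma CenteredGaussianProcess.memLp_at (G : CenteredGaussianProcess P) (t : ℝ) :
    MemLp (G.at t) 2 P :=
  (G.isGaussian.hasGaussianLaw_eval t.toNNReal).memLp_two

lemma CenteredGaussianProcess.memLp_stepIntegral (G : CenteredGaussianProcess P) {f : ℝ → ℝ}
    (hf : IsTame f) : MemLp (G.stepIntegral f) 2 P := by
  have h : G.stepIntegral f = fun ω => ∑ x ∈ hf.2.toFinset, drop f x * G.at x ω := by
    funext ω
    refine finsum_eq_sum_of_support_subset _ fun x hx => ?_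
    simpa using left_ne_zero_of_mul hx
  rw [h]
  exact memLp_finsetSum _ fun x _ => (G.memLp_at x).const_mul _

/-- The step functions on `[0,T]`, to be equipped with the inner product
determined by the process `G`. -/
def Step (_G : CenteredGaussianProcess P) (T : ℝ) : Type := stepFunctions T

instance (G : CenteredGaussianProcess P) (T : ℝ) : AddCommGroup (Step G T) :=
  inferInstanceAs (AddCommGroup (stepFunctions T))

instance (G : CenteredGaussianProcess P) (T : ℝ) : Module ℝ (Step G T) :=
  inferInstanceAs (Module ℝ (stepFunctions T))

/-- The underlying function of a step function. -/
def Step.fn {G : CenteredGaussianProcess P} {T : ℝ} (f : Step G T) : ℝ → ℝ :=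
  Subtype.val (p := fun f => f ∈ stepFunctions T) f

lemma Step.isTame {G : CenteredGaussianProcess P} {T : ℝ} (f : Step G T) : IsTame f.fn :=
  isTame_of_mem (T := T) (Subtype.prop (p := fun f => f ∈ stepFunctions T) f)

/-- The inner product `⟨f, g⟩ = E[G(f) G(g)]` of step functions: the bilinear form with
`⟨1_{[a,b)}, 1_{[c,d)}⟩ = E[(G_b - G_a)(G_d - G_c)]`. -/
@[reducible] def Step.core (G : CenteredGaussianProcess P) (T : ℝ) :
    PreInnerProductSpace.Core ℝ (Step G T) where
  inner f g := ∫ ω, G.stepIntegral f.fn ω * G.stepIntegral g.fn ω ∂P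
  conj_inner_symm f g := by simp [mul_comm]
  re_inner_nonneg f := by
    simpa using integral_nonneg fun ω => mul_self_nonneg (G.stepIntegral f.fn ω)
  add_left f g h := by
    have e : G.stepIntegral (f + g).fn = G.stepIntegral f.fn + G.stepIntegral g.fn :=
      G.stepIntegral_add f.isTame g.isTame
    simp only [e, Pi.add_apply, add_mul]
    exact integral_add
      ((G.memLp_stepIntegral f.isTame).integrable_mul (G.memLp_stepIntegral h.isTame))
      ((G.memLp_stepIntegral g.isTame).integrable_mul (G.memLp_stepIntegral h.isTame))
  smul_left f g r := by
    have e : G.stepIntegral (r • f).fn = r • G.stepIntegral f.fn :=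
      G.stepIntegral_smul r f.isTame
    simp only [e, Pi.smul_apply, smul_eq_mul, mul_assoc, integral_const_mul]
    simp

instance (G : CenteredGaussianProcess P) (T : ℝ) : SeminormedAddCommGroup (Step G T) :=
  @InnerProductSpace.Core.toSeminormedAddCommGroup ℝ (Step G T) _ _ _ (Step.core G T)

instance (G : CenteredGaussianProcess P) (T : ℝ) : InnerProductSpace ℝ (Step G T) :=
  InnerProductSpace.ofCore (Step.core G T)

/-- The Hilbert space `𝔥` of the process `G` on `[0,T]`: the completion of the step functions
(completing also identifies step functions at distance `0`). -/
abbrev HSpace (G : CenteredGaussianProcess P) (T : ℝ) : Type :=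
  UniformSpace.Completion (Step G T)

/-- The step function `1_{[a,b)}` (restricted to `[0,T)` if `[a,b)` is not contained in it). -/
def Step.ind (G : CenteredGaussianProcess P) (T a b : ℝ) : Step G T :=
  ⟨(Ico (max a 0) (min b T)).indicator 1,
    Submodule.subset_span ⟨_, _, le_max_right _ _, min_le_right _ _, rfl⟩⟩

/-- `1_{[a,b)}` as an element of `𝔥`. -/
def indH (G : CenteredGaussianProcess P) (T a b : ℝ) : HSpace G T :=
  (Step.ind G T a b : UniformSpace.Completion (Step G T))

lemma inner_indH (G : CenteredGaussianProcess P) (T : ℝ) {a b c d : ℝ} (ha : 0 ≤ a) (hab : a ≤ b)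
    (hb : b ≤ T) (hc : 0 ≤ c) (hcd : c ≤ d) (hd : d ≤ T) :
    inner ℝ (indH G T a b) (indH G T c d) =
      ∫ ω, (G.at b ω - G.at a ω) * (G.at d ω - G.at c ω) ∂P := by
  rw [indH, indH, UniformSpace.Completion.inner_coe]
  change ∫ ω, G.stepIntegral (Step.ind G T a b).fn ω * G.stepIntegral (Step.ind G T c d).fn ω ∂P
    = _
  have h : ∀ a b : ℝ, 0 ≤ a → a ≤ b → b ≤ T → ∀ ω,
      G.stepIntegral (Step.ind G T a b).fn ω = G.at b ω - G.at a ω := by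
    intro a b ha hab hb ω
    have : (Step.ind G T a b).fn = (Ico a b).indicator 1 := by
      change (Ico (max a 0) (min b T)).indicator 1 = _
      rw [max_eq_left ha, min_eq_left hb]
    rw [this, G.stepIntegral_indicator hab]
  simp only [h a b ha hab hb, h c d hc hcd hd]

/-! ### Hilbert tensor square and contraction -/

section Contraction

variable (E : Type*) [NormedAddCommGroup E] [InnerProductSpace ℝ E]

/-- The Hilbert-space tensor product `E^{⊗2}`: the completion of the algebraic tensor product for
`⟨a ⊗ b, c ⊗ d⟩ = ⟨a, c⟩ ⟨b, d⟩`. -/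
abbrev HTensor : Type _ := UniformSpace.Completion (E ⊗[ℝ] E)

variable {E}

/-- The elementary tensor `x ⊗ y` in `E^{⊗2}`. -/
def htmul (x y : E) : HTensor E := ((x ⊗ₜ[ℝ] y : E ⊗[ℝ] E) : UniformSpace.Completion (E ⊗[ℝ] E))

lemma inner_htmul (a b c d : E) :
    inner ℝ (htmul a b) (htmul c d) = inner ℝ a c * inner ℝ b d := by
  rw [htmul, htmul, UniformSpace.Completion.inner_coe, TensorProduct.inner_tmul]

lemma norm_htmul (x y : E) : ‖htmul x y‖ = ‖x‖ * ‖y‖ := by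
  rw [htmul, UniformSpace.Completion.norm_coe, TensorProduct.norm_tmul]

/-- The bounded linear map `x ↦ x ⊗ y`. -/
def htmulRight (y : E) : E →L[ℝ] HTensor E :=
  LinearMap.mkContinuous
    { toFun := fun x => htmul x y
      map_add' := fun x x' => by
        simp only [htmul, TensorProduct.add_tmul, UniformSpace.Completion.coe_add]
      map_smul' := fun c x => by
        simp only [htmul, ← TensorProduct.smul_tmul', UniformSpace.Completion.coe_smul,
          RingHom.id_apply] }
    ‖y‖ fun x => by
      change ‖htmul x y‖ ≤ _
      rw [norm_htmul, mul_comm]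

variable [CompleteSpace E]

/-- The partial inner product `⟨F, y⟩ ∈ E` of `F ∈ E^{⊗2}` with `y ∈ E`, in the second variable:
the vector with `⟨x, ⟨F, y⟩⟩ = ⟨F, x ⊗ y⟩` for all `x`, so that `⟨a ⊗ b, y⟩ = ⟨b, y⟩ a`. -/
def partialInner (F : HTensor E) (y : E) : E :=
  (InnerProductSpace.toDual ℝ E).symm ((innerSL ℝ F).comp (htmulRight y))

lemma inner_partialInner (F : HTensor E) (x y : E) :
    inner ℝ (partialInner F y) x = inner ℝ F (htmul x y) := by
  rw [partialInner, InnerProductSpace.toDual_symm_apply]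
  rfl

lemma partialInner_htmul (a b y : E) : partialInner (htmul a b) y = inner ℝ b y • a := by
  refine ext_inner_right ℝ fun x => ?_
  rw [inner_partialInner, inner_htmul, real_inner_smul_left, mul_comm]

/-- The first contraction `f ⊗₁ g = ∑_i ⟨f, e_i⟩ ⊗ ⟨g, e_i⟩`, computed in the complete orthonormal
system `e`. -/
def contraction {ι : Type*} (e : HilbertBasis ι ℝ E) (f g : HTensor E) : HTensor E :=
  ∑' i, htmul (partialInner f (e i)) (partialInner g (e i))

lemma summable_sq_partialInner {ι : Type*} (e : HilbertBasis ι ℝ E) (f : HTensor E) :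
    Summable fun i => ‖partialInner f (e i)‖ ^ 2 := by
  classical
  have ho : Orthonormal ℝ fun p : ι × ι => htmul (e p.1) (e p.2) := by
    rw [orthonormal_iff_ite]
    rintro ⟨i, j⟩ ⟨k, l⟩
    rw [inner_htmul, orthonormal_iff_ite.1 e.orthonormal, orthonormal_iff_ite.1 e.orthonormal]
    by_cases h1 : i = k <;> by_cases h2 : j = l <;> simp [h1, h2]
  have hs := (ho.inner_products_summable (x := f)).prod_symm.prod
  refine hs.congr fun j => ?_
  have hp := e.hasSum_inner_mul_inner (partialInner f (e j)) (partialInner f (e j))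
  rw [real_inner_self_eq_norm_sq] at hp
  rw [← hp.tsum_eq]
  refine tsum_congr fun i => ?_
  rw [real_inner_comm (partialInner f (e j)) (e i), inner_partialInner, Real.norm_eq_abs, sq_abs,
    sq, real_inner_comm]
  rfl

/-- The series defining the contraction always converges. -/
lemma summable_contraction {ι : Type*} (e : HilbertBasis ι ℝ E) (f g : HTensor E) :
    Summable fun i => htmul (partialInner f (e i)) (partialInner g (e i)) := by
  refine Summable.of_norm_bounded
    ((summable_sq_partialInner e f).add (summable_sq_partialInner e g)) fun i => ?_
  rw [norm_htmul]
  nlinarith [sq_nonneg (‖partialInner f (e i)‖ - ‖partialInner g (e i)‖),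
    sq_nonneg (‖partialInner f (e i)‖), sq_nonneg (‖partialInner g (e i)‖)]

end Contraction

/-! ### Two-variable functions as elements of `𝔥^{⊗2}` -/

/-- The step function `∑_{i,j<n} φ(t_i, t_j) 1_{[t_i,t_{i+1})} ⊗ 1_{[t_j,t_{j+1})}` obtained from `φ`
and the partition `t_0 ≤ ⋯ ≤ t_n`. -/
def discretize (G : CenteredGaussianProcess P) (T : ℝ) (φ : ℝ → ℝ → ℝ) (n : ℕ) (t : ℕ → ℝ) :
    HTensor (HSpace G T) :=
  ∑ i ∈ Finset.range n, ∑ j ∈ Finset.range n,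
    φ (t i) (t j) • htmul (indH G T (t i) (t (i + 1))) (indH G T (t j) (t (j + 1)))

/-- `F ∈ 𝔥^{⊗2}` is the element given by the function `φ` on `[0,T]²`: the step functions obtained
from `φ` along partitions `0 = t_0 ≤ ⋯ ≤ t_n = T` converge to `F` in `𝔥^{⊗2}` as the mesh
tends to `0`. -/
def Represents (G : CenteredGaussianProcess P) (T : ℝ) (φ : ℝ → ℝ → ℝ)
    (F : HTensor (HSpace G T)) : Prop :=
  ∀ ε > 0, ∃ η > 0, ∀ (n : ℕ) (t : ℕ → ℝ), t 0 = 0 → t n = T →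
    (∀ i < n, t i ≤ t (i + 1) ∧ t (i + 1) - t i < η) → ‖discretize G T φ n t - F‖ < ε

/-- A function on `[0,T]²` gives at most one element of `𝔥^{⊗2}`. -/
lemma Represents.unique {G : CenteredGaussianProcess P} {T : ℝ} (hT : 0 ≤ T) {φ : ℝ → ℝ → ℝ}
    {F F' : HTensor (HSpace G T)} (h : Represents G T φ F) (h' : Represents G T φ F') :
    F = F' := by
  refine eq_of_sub_eq_zero (norm_eq_zero.1 (le_antisymm (le_of_forall_pos_lt_add fun ε hε => ?_)
    (norm_nonneg _)))
  obtain ⟨η, hη, h⟩ := h (ε / 2) (half_pos hε)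
  obtain ⟨η', hη', h'⟩ := h' (ε / 2) (half_pos hε)
  obtain ⟨n, hn⟩ := exists_nat_gt (T / min η η')
  have hm : 0 < min η η' := lt_min hη hη'
  have hn0 : (0 : ℝ) < n := (div_nonneg hT hm.le).trans_lt hn
  have hstep : ∀ i : ℕ, ((i + 1 : ℕ) : ℝ) * (T / n) - i * (T / n) = T / n := by
    intro i; push_cast; ring
  have hlt : T / n < min η η' := by
    rw [div_lt_iff₀ hn0]
    rwa [div_lt_iff₀ hm, mul_comm] at hn
  have hpos : 0 ≤ T / n := div_nonneg hT hn0.le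
  have e1 := h n (fun i => i * (T / n)) (by simp) (by field_simp) fun i _ =>
    ⟨by linarith [hstep i], by linarith [hstep i, min_le_left η η']⟩
  have e2 := h' n (fun i => i * (T / n)) (by simp) (by field_simp) fun i _ =>
    ⟨by linarith [hstep i], by linarith [hstep i, min_le_right η η']⟩
  have e3 := norm_sub_le_norm_sub_add_norm_sub F (discretize G T φ n fun i => i * (T / n)) F'
  rw [norm_sub_rev F (discretize _ _ _ _ _)] at e3
  linarith

/-- The kernel `f_T(t,s) = e^{-θ|t-s|} 1_{0 ≤ s,t ≤ T}`. -/
def fKernel (θ T t s : ℝ) : ℝ :=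
  if t ∈ Icc 0 T ∧ s ∈ Icc 0 T then Real.exp (-θ * |t - s|) else 0

/-- The exponent `δ`: `1/2` for `H < 1/4` and `3/2 - 4H` for `H > 1/4`. -/
def deltaExp (H : ℝ) : ℝ := if H < 1 / 4 then 1 / 2 else 3 / 2 - 4 * H

end

end GaussianOU

universe u

open GaussianOU

/-!
The proof gives the bound `‖f_T ⊗₁ f_T‖ ≤ k √T` for every `H < 1/2`; it implies both claims, since
`δ ≤ 1/2`.

The kernel `e^{-θ|t-s|}` is positive definite, with the explicit square root
`e^{-θ|t-s|} = ∫ h_r(t) h_r(s) dν(r)`, where `h_r(t) = 1_{r ≤ t} e^{-θ(t-r)}` and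
`ν = δ₀ + 2θ dr` on `[0,T]` (`integral_mixMeasure_exp`). Hence `f_T` is the element
`F = ∫ X_r ⊗ X_r dν(r)` of `𝔥^{⊗2}`, where `X_r = ∫_r^T e^{-θ(t-r)} dG_t` is a backward
Ornstein–Uhlenbeck curve in `𝔥`. Since `e^{-θv}` is the tail of the exponential law, `X_r` is the
mean of the increment of `G` from `r` to `min (r + v) T` for an exponential time `v`, so that no
Stieltjes integral is needed: `X_r` is defined for every continuous covariance, and the step
functions converge to `F` by the uniform continuity of `t ↦ 1_{[0,t)}` (`represents_fKernel`).

For elements of this form, `‖F ⊗₁ F‖² = ∬ (∫ K(u,r) K(u,s) dν(u))² dν(r) dν(s)` with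
`K(r,s) = ⟨X_r, X_s⟩` (`norm_sq_contraction_integral_htmul`). The kernel `K` is a mean of covariances
of increments of `G`. For fractional Brownian motion with `H < 1/2` these decay like
`|r - s|^{2H-2}`, uniformly in `T` (`abs_rectInc_fbmCov_le`); the hypothesis on the noise bounds the
covariances of increments of `R - R^B` by those of `C' H⁻² (ts)^H`
(`NoiseHypothesis.abs_rectInc_sub_le`). So
`|K(r,s)| ≤ A ((1+|r-s|)^{2H-2} + (1+r)^{H-1} (1+s)^{H-1})` (`abs_inner_backwardOU_le`).
As `2H - 2 < -1`, the first term is a kernel with bounded row sums and the second one has rank one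
and finite Hilbert–Schmidt norm; this bounds the double integral by a multiple of
`ν(ℝ) ≤ (1 + 2θ) T` (`integral_integral_sq_le`).
-/

namespace GaussianOU

/-! ### Increments of real functions -/

/-- If `|f'| ≤ m'` in the interior, the increment of `f` is bounded by that of `m`. -/
lemma abs_sub_le_of_abs_deriv_le {f m : ℝ → ℝ} {a b : ℝ} (hab : a ≤ b)
    (hf : ContinuousOn f (Icc a b)) (hm : ContinuousOn m (Icc a b))
    (hf' : ∀ x ∈ Ioo a b, DifferentiableAt ℝ f x) (hm' : ∀ x ∈ Ioo a b, DifferentiableAt ℝ m x)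
    (h : ∀ x ∈ Ioo a b, |deriv f x| ≤ deriv m x) : |f b - f a| ≤ m b - m a := by
  have h1 : MonotoneOn (fun x => m x - f x) (Icc a b) := by
    refine monotoneOn_of_deriv_nonneg (convex_Icc a b) (hm.sub hf) ?_ ?_
    · rw [interior_Icc]
      exact fun x hx => ((hm' x hx).sub (hf' x hx)).differentiableWithinAt
    · rw [interior_Icc]
      intro x hx
      rw [deriv_fun_sub (hm' x hx) (hf' x hx)]
      linarith [(abs_le.1 (h x hx)).2]
  have h2 : MonotoneOn (fun x => m x + f x) (Icc a b) := by
    refine monotoneOn_of_deriv_nonneg (convex_Icc a b) (hm.add hf) ?_ ?_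
    · rw [interior_Icc]
      exact fun x hx => ((hm' x hx).add (hf' x hx)).differentiableWithinAt
    · rw [interior_Icc]
      intro x hx
      rw [deriv_fun_add (hm' x hx) (hf' x hx)]
      linarith [(abs_le.1 (h x hx)).1]
  have i1 := h1 (left_mem_Icc.2 hab) (right_mem_Icc.2 hab) hab
  have i2 := h2 (left_mem_Icc.2 hab) (right_mem_Icc.2 hab) hab
  simp only at i1 i2
  rw [abs_le]
  constructor <;> linarith

/-- The bound of `abs_sub_le_of_abs_deriv_le`, with one exceptional point. -/
lemma abs_sub_le_of_abs_deriv_le_of_ne {f m : ℝ → ℝ} {a b : ℝ} (c : ℝ) (hab : a ≤ b)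
    (hf : ContinuousOn f (Icc a b)) (hm : ContinuousOn m (Icc a b))
    (hf' : ∀ x ∈ Ioo a b, x ≠ c → DifferentiableAt ℝ f x)
    (hm' : ∀ x ∈ Ioo a b, DifferentiableAt ℝ m x)
    (h : ∀ x ∈ Ioo a b, x ≠ c → |deriv f x| ≤ deriv m x) : |f b - f a| ≤ m b - m a := by
  by_cases hc : c ∈ Ioo a b
  · have l1 : Icc a c ⊆ Icc a b := Icc_subset_Icc_right hc.2.le
    have l2 : Icc c b ⊆ Icc a b := Icc_subset_Icc_left hc.1.le
    have l3 : Ioo a c ⊆ Ioo a b := Ioo_subset_Ioo_right hc.2.le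
    have l4 : Ioo c b ⊆ Ioo a b := Ioo_subset_Ioo_left hc.1.le
    have e1 := abs_sub_le_of_abs_deriv_le hc.1.le (hf.mono l1) (hm.mono l1)
      (fun x hx => hf' x (l3 hx) hx.2.ne) (fun x hx => hm' x (l3 hx))
      (fun x hx => h x (l3 hx) hx.2.ne)
    have e2 := abs_sub_le_of_abs_deriv_le hc.2.le (hf.mono l2) (hm.mono l2)
      (fun x hx => hf' x (l4 hx) hx.1.ne') (fun x hx => hm' x (l4 hx))
      (fun x hx => h x (l4 hx) hx.1.ne')
    have := abs_sub_le (f b) (f c) (f a)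
    linarith
  · exact abs_sub_le_of_abs_deriv_le hab hf hm (fun x hx => hf' x hx fun e => hc (e ▸ hx)) hm'
      (fun x hx => h x hx fun e => hc (e ▸ hx))

/-- The bound of `abs_sub_le_of_abs_deriv_le`, with two exceptional points. -/
lemma abs_sub_le_of_abs_deriv_le_of_ne_of_ne {f m : ℝ → ℝ} {a b : ℝ} (c d : ℝ) (hab : a ≤ b)
    (hf : ContinuousOn f (Icc a b)) (hm : ContinuousOn m (Icc a b))
    (hf' : ∀ x ∈ Ioo a b, x ≠ c → x ≠ d → DifferentiableAt ℝ f x)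
    (hm' : ∀ x ∈ Ioo a b, DifferentiableAt ℝ m x)
    (h : ∀ x ∈ Ioo a b, x ≠ c → x ≠ d → |deriv f x| ≤ deriv m x) :
    |f b - f a| ≤ m b - m a := by
  by_cases hc : c ∈ Ioo a b
  · have l1 : Icc a c ⊆ Icc a b := Icc_subset_Icc_right hc.2.le
    have l2 : Icc c b ⊆ Icc a b := Icc_subset_Icc_left hc.1.le
    have l3 : Ioo a c ⊆ Ioo a b := Ioo_subset_Ioo_right hc.2.le
    have l4 : Ioo c b ⊆ Ioo a b := Ioo_subset_Ioo_left hc.1.le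
    have e1 := abs_sub_le_of_abs_deriv_le_of_ne d hc.1.le (hf.mono l1) (hm.mono l1)
      (fun x hx => hf' x (l3 hx) hx.2.ne) (fun x hx => hm' x (l3 hx))
      (fun x hx => h x (l3 hx) hx.2.ne)
    have e2 := abs_sub_le_of_abs_deriv_le_of_ne d hc.2.le (hf.mono l2) (hm.mono l2)
      (fun x hx => hf' x (l4 hx) hx.1.ne') (fun x hx => hm' x (l4 hx))
      (fun x hx => h x (l4 hx) hx.1.ne')
    have := abs_sub_le (f b) (f c) (f a)
    linarith
  · exact abs_sub_le_of_abs_deriv_le_of_ne d hab hf hm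
      (fun x hx => hf' x hx fun e => hc (e ▸ hx)) hm'
      (fun x hx => h x hx fun e => hc (e ▸ hx))

/-! ### Power functions -/

lemma rpow_le_one_add_sq {p x : ℝ} (hx : 0 ≤ x) (hp0 : 0 ≤ p) (hp : p ≤ 2) :
    x ^ p ≤ 1 + x ^ 2 := by
  rcases le_total x 1 with h | h
  · have := Real.rpow_le_one hx h hp0
    nlinarith [sq_nonneg x]
  · have := Real.rpow_le_rpow_of_exponent_le h hp
    rw [Real.rpow_two] at this
    linarith

lemma abs_rpow_sub_rpow_le {p x y : ℝ} (hx : 0 ≤ x) (hy : 0 ≤ y) (hp0 : 0 ≤ p) (hp : p ≤ 1) :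
    |x ^ p - y ^ p| ≤ |x - y| ^ p := by
  wlog h : y ≤ x generalizing x y
  · rw [abs_sub_comm, abs_sub_comm x]
    exact this hy hx (le_of_not_ge h)
  have h1 := Real.rpow_add_le_add_rpow (sub_nonneg.2 h) hy hp0 hp
  rw [sub_add_cancel] at h1
  rw [abs_of_nonneg (sub_nonneg.2 (Real.rpow_le_rpow hy h hp0)), abs_of_nonneg (sub_nonneg.2 h)]
  linarith

/-- A power `p ∈ [-2, 0]` changes by a factor at most `4` when its base is halved. -/
lemma rpow_half_le {p x : ℝ} (hx : 0 < x) (hp : -2 ≤ p) :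
    (x / 2) ^ p ≤ 4 * x ^ p := by
  rw [Real.div_rpow hx.le zero_le_two, div_le_iff₀ (by positivity)]
  have h1 : (2 : ℝ) ^ (-2 : ℝ) ≤ 2 ^ p := Real.rpow_le_rpow_of_exponent_le one_le_two hp
  have h2 : (2 : ℝ) ^ (-2 : ℝ) = 1 / 4 := by
    rw [Real.rpow_neg zero_le_two, Real.rpow_two]; norm_num
  have h3 : 0 ≤ x ^ p := Real.rpow_nonneg hx.le p
  nlinarith [mul_le_mul_of_nonneg_left (h2 ▸ h1) h3]

/-- Second differences of a power function with exponent in `[0,1]`. -/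
lemma abs_second_diff_rpow_le {α x p q : ℝ} (hα0 : 0 ≤ α) (hα : α ≤ 1) (hx : 0 < x) (hp : 0 ≤ p)
    (hq : 0 ≤ q) :
    |(x + p + q) ^ α - (x + p) ^ α - ((x + q) ^ α - x ^ α)| ≤ p * q * x ^ (α - 2) := by
  have key : ∀ y, x ≤ y → |(y + q) ^ (α - 1) - y ^ (α - 1)| ≤ q * x ^ (α - 2) := by
    intro y hy
    have hc : ContinuousOn (fun z : ℝ => z ^ (α - 1)) (Icc y (y + q)) := fun z hz =>
      (Real.continuousAt_rpow_const _ _ (Or.inl (by linarith [hz.1]))).continuousWithinAt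
    have h := abs_sub_le_of_abs_deriv_le (f := fun z : ℝ => z ^ (α - 1))
      (m := fun z => x ^ (α - 2) * z) (a := y) (b := y + q) (by linarith) hc (by fun_prop)
      (fun z hz => Real.differentiableAt_rpow_const_of_ne _ (by linarith [hz.1]))
      (fun z hz => by fun_prop) fun z hz => by
        have hz0 : 0 < z := by linarith [hz.1]
        rw [Real.deriv_rpow_const, show deriv (fun z => x ^ (α - 2) * z) z = x ^ (α - 2) by simp,
          abs_mul, show α - 1 - 1 = α - 2 by ring, abs_of_pos (Real.rpow_pos_of_pos hz0 _)]
        have h1 : z ^ (α - 2) ≤ x ^ (α - 2) :=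
          Real.rpow_le_rpow_of_nonpos hx (by linarith [hz.1]) (by linarith)
        have h2 : |α - 1| ≤ 1 := by rw [abs_le]; constructor <;> linarith
        have h3 : 0 ≤ z ^ (α - 2) := Real.rpow_nonneg hz0.le _
        nlinarith [abs_nonneg (α - 1)]
    linarith
  have hc : ∀ e : ℝ, 0 ≤ e → ContinuousOn (fun y : ℝ => (y + e) ^ α) (Icc x (x + p)) := fun e he =>
    ContinuousOn.rpow_const (by fun_prop) fun z hz => Or.inr hα0
  have hd : ∀ e : ℝ, 0 ≤ e → ∀ y ∈ Ioo x (x + p),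
      HasDerivAt (fun y : ℝ => (y + e) ^ α) (α * (y + e) ^ (α - 1)) y := fun e he y hy => by
    have := ((hasDerivAt_id y).add_const e).rpow_const (p := α)
      (Or.inl (by simp only [id]; linarith [hy.1]))
    simpa using this
  have h := abs_sub_le_of_abs_deriv_le (f := fun y : ℝ => (y + q) ^ α - (y + 0) ^ α)
    (m := fun z => q * x ^ (α - 2) * z) (a := x) (b := x + p) (by linarith)
    ((hc q hq).sub (hc 0 le_rfl)) (by fun_prop)
    (fun y hy => ((hd q hq y hy).sub (hd 0 le_rfl y hy)).differentiableAt)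
    (fun z hz => by fun_prop) fun y hy => by
      rw [((hd q hq y hy).fun_sub (hd 0 le_rfl y hy)).deriv,
        show deriv (fun z => q * x ^ (α - 2) * z) y = q * x ^ (α - 2) by simp, add_zero, ← mul_sub,
        abs_mul, abs_of_nonneg hα0]
      have h1 := key y hy.1.le
      nlinarith [abs_nonneg ((y + q) ^ (α - 1) - y ^ (α - 1))]
  simp only [add_zero] at h
  calc _ ≤ _ := h
    _ = _ := by ring

/-- The increment of `x ↦ x^H` decays like `(1 + a)^{H-1}`. -/
lemma rpow_sub_rpow_le {H a b : ℝ} (hH0 : 0 < H) (hH : H ≤ 1) (ha : 0 ≤ a) (hab : a ≤ b) :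
    b ^ H - a ^ H ≤ 4 * (1 + (b - a) ^ 2) * (1 + a) ^ (H - 1) := by
  have hp : 0 ≤ b - a := sub_nonneg.2 hab
  have hw : 0 < (1 + a) ^ (H - 1) := by positivity
  rcases le_total a 1 with h | h
  · have h1 := abs_rpow_sub_rpow_le (ha.trans hab) ha hH0.le hH
    have h2 := rpow_le_one_add_sq hp hH0.le (by linarith)
    rw [abs_of_nonneg hp] at h1
    have h3 : (1 : ℝ) ≤ 4 * (1 + a) ^ (H - 1) := by
      have h4 : (2 : ℝ) ^ (H - 1) ≤ (1 + a) ^ (H - 1) :=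
        Real.rpow_le_rpow_of_nonpos (by linarith) (by linarith) (by linarith)
      have h5 := rpow_half_le (p := H - 1) (x := 2) (by norm_num) (by linarith)
      rw [div_self two_ne_zero, Real.one_rpow] at h5
      linarith
    have := le_abs_self (b ^ H - a ^ H)
    nlinarith [sq_nonneg (b - a)]
  · have hc : ContinuousOn (fun z : ℝ => z ^ H) (Icc a b) :=
      (Real.continuous_rpow_const hH0.le).continuousOn
    have h1 := abs_sub_le_of_abs_deriv_le (f := fun z : ℝ => z ^ H)
      (m := fun z => a ^ (H - 1) * z) hab hc (by fun_prop)
      (fun z hz => Real.differentiableAt_rpow_const_of_ne _ (by linarith [hz.1]))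
      (fun z hz => by fun_prop) fun z hz => by
        have hz0 : 0 < z := by linarith [hz.1]
        rw [Real.deriv_rpow_const, show deriv (fun z => a ^ (H - 1) * z) z = a ^ (H - 1) by simp,
          abs_mul, abs_of_pos (Real.rpow_pos_of_pos hz0 _), abs_of_pos hH0]
        have h1 : z ^ (H - 1) ≤ a ^ (H - 1) :=
          Real.rpow_le_rpow_of_nonpos (by linarith) (by linarith [hz.1]) (by linarith)
        have h3 : 0 ≤ z ^ (H - 1) := Real.rpow_nonneg hz0.le _
        nlinarith
    have h2 : a ^ (H - 1) ≤ 4 * (1 + a) ^ (H - 1) :=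
      (Real.rpow_le_rpow_of_nonpos (by linarith) (by linarith) (by linarith)).trans
        (rpow_half_le (p := H - 1) (x := 1 + a) (by linarith) (by linarith))
    have := le_abs_self (b ^ H - a ^ H)
    have h3 : a ^ (H - 1) * (b - a) ≤ 4 * (1 + a) ^ (H - 1) * (b - a) := by gcongr
    nlinarith [sq_nonneg (b - a - 1)]

/-! ### Rectangular increments -/

/-- The increment of a function of two variables over the rectangle `[a,b] × [c,d]`. -/
def rectInc (R : ℝ → ℝ → ℝ) (a b c d : ℝ) : ℝ := R b d - R a d - R b c + R a c

lemma rectInc_fbmCov (H a b c d : ℝ) : rectInc (fbmCov H) a b c d =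
    (1 / 2) * (|b - c| ^ (2 * H) + |a - d| ^ (2 * H) - |a - c| ^ (2 * H) - |b - d| ^ (2 * H)) := by
  simp only [rectInc, fbmCov]
  ring

/-- The correlation of two increments of a fractional Brownian motion with `H ≤ 1/2` decays like
`|a - c|^{2H-2}`, uniformly for bounded lengths of the increments. -/
lemma abs_rectInc_fbmCov_le {H a b c d : ℝ} (hH0 : 0 < H) (hH : H ≤ 1 / 2) (hab : a ≤ b)
    (hcd : c ≤ d) : |rectInc (fbmCov H) a b c d| ≤
      32 * (1 + (b - a) ^ 2) * (1 + (d - c) ^ 2) * (1 + |a - c|) ^ (2 * H - 2) := by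
  wlog h : a ≤ c generalizing a b c d
  · have := this hcd hab (le_of_not_ge h)
    rw [rectInc_fbmCov] at this ⊢
    rw [abs_sub_comm a c, abs_sub_comm b c, abs_sub_comm a d, abs_sub_comm b d]
    convert this using 1
    · congr 1; ring
    · ring
  set ℓ := c - a with hℓ
  have hℓ0 : 0 ≤ ℓ := sub_nonneg.2 h
  have hp : 0 ≤ b - a := sub_nonneg.2 hab
  have hq : 0 ≤ d - c := sub_nonneg.2 hcd
  have hac : |a - c| = ℓ := by rw [abs_sub_comm, abs_of_nonneg hℓ0]
  -- the crude bound, by subadditivity of the power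
  have b1 : |rectInc (fbmCov H) a b c d| ≤ (b - a) ^ (2 * H) := by
    rw [rectInc_fbmCov]
    have aux : ∀ e, |(|b - e| ^ (2 * H) - |a - e| ^ (2 * H))| ≤ (b - a) ^ (2 * H) := fun e => by
      refine (abs_rpow_sub_rpow_le (abs_nonneg _) (abs_nonneg _) (by linarith) (by linarith)).trans
        (Real.rpow_le_rpow (abs_nonneg _) ?_ (by linarith))
      have := abs_abs_sub_abs_le_abs_sub (b - e) (a - e)
      rwa [sub_sub_sub_cancel_right, abs_of_nonneg hp] at this
    have h1 := abs_le.1 (aux c)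
    have h2 := abs_le.1 (aux d)
    rw [abs_le]
    constructor <;> linarith [h1.1, h1.2, h2.1, h2.2]
  have b2 : (b - a) ^ (2 * H) ≤ 1 + (b - a) ^ 2 :=
    rpow_le_one_add_sq hp (by linarith) (by linarith)
  have hw : 0 < (1 + ℓ) ^ (2 * H - 2) := by positivity
  rw [hac]
  have hpq : 1 + (b - a) ^ 2 ≤ (1 + (b - a) ^ 2) * (1 + (d - c) ^ 2) :=
    le_mul_of_one_le_right (by positivity) (by nlinarith [sq_nonneg (d - c)])
  rcases le_or_gt ℓ 1 with h1 | h1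
  · have h2 : 1 ≤ 4 * (1 + ℓ) ^ (2 * H - 2) := by
      have h4 : (2 : ℝ) ^ (2 * H - 2) ≤ (1 + ℓ) ^ (2 * H - 2) :=
        Real.rpow_le_rpow_of_nonpos (by linarith) (by linarith) (by linarith)
      have h5 := rpow_half_le (p := 2 * H - 2) (x := 2) (by norm_num) (by linarith)
      rw [div_self two_ne_zero, Real.one_rpow] at h5
      linarith
    calc _ ≤ (1 + (b - a) ^ 2) * (1 + (d - c) ^ 2) := b1.trans (b2.trans hpq)
      _ = (1 + (b - a) ^ 2) * (1 + (d - c) ^ 2) * 1 := by ring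
      _ ≤ (1 + (b - a) ^ 2) * (1 + (d - c) ^ 2) * (32 * (1 + ℓ) ^ (2 * H - 2)) := by
          gcongr; linarith
      _ = _ := by ring
  · have hℓw : ℓ ^ (2 * H - 2) ≤ 4 * (1 + ℓ) ^ (2 * H - 2) :=
      (Real.rpow_le_rpow_of_nonpos (by linarith) (by linarith) (by linarith)).trans
        (rpow_half_le (p := 2 * H - 2) (x := 1 + ℓ) (by linarith) (by linarith))
    have hℓ2 : (ℓ / 2) ^ (2 * H - 2) ≤ 4 * ℓ ^ (2 * H - 2) :=
      rpow_half_le (by linarith) (by linarith)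
    have hW : 0 ≤ (ℓ / 2) ^ (2 * H - 2) := by positivity
    suffices h : |rectInc (fbmCov H) a b c d| ≤
        2 * ((1 + (b - a) ^ 2) * (1 + (d - c) ^ 2)) * (ℓ / 2) ^ (2 * H - 2) by
      calc _ ≤ _ := h
        _ ≤ 2 * ((1 + (b - a) ^ 2) * (1 + (d - c) ^ 2)) * (16 * (1 + ℓ) ^ (2 * H - 2)) := by
          gcongr; linarith
        _ = _ := by ring
    rcases le_or_gt (b - a) (ℓ / 2) with h2 | h2
    · -- the increments are separated: the second difference of `x ^ (2H)` is small
      have hx : ℓ / 2 ≤ c - b := by linarith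
      have h3 := abs_second_diff_rpow_le (α := 2 * H) (x := c - b) (p := b - a) (q := d - c)
        (by linarith) (by linarith) (by linarith) hp hq
      have h4 : (c - b) ^ (2 * H - 2) ≤ (ℓ / 2) ^ (2 * H - 2) :=
        Real.rpow_le_rpow_of_nonpos (by linarith) hx (by linarith)
      rw [rectInc_fbmCov, abs_sub_comm b c, abs_sub_comm a d, abs_sub_comm a c, abs_sub_comm b d,
        abs_of_nonneg (by linarith : 0 ≤ c - b), abs_of_nonneg (by linarith : 0 ≤ d - a),
        abs_of_nonneg (by linarith : 0 ≤ c - a), abs_of_nonneg (by linarith : 0 ≤ d - b), abs_mul]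
      rw [show c - b + (b - a) + (d - c) = d - a by ring, show c - b + (b - a) = c - a by ring,
        show c - b + (d - c) = d - b by ring] at h3
      rw [show (c - b) ^ (2 * H) + (d - a) ^ (2 * H) - (c - a) ^ (2 * H) - (d - b) ^ (2 * H) =
        (d - a) ^ (2 * H) - (c - a) ^ (2 * H) - ((d - b) ^ (2 * H) - (c - b) ^ (2 * H)) by ring,
        abs_of_pos (by norm_num : (0 : ℝ) < 1 / 2)]
      have h5 : (b - a) * (d - c) ≤ (1 + (b - a) ^ 2) * (1 + (d - c) ^ 2) := by
        nlinarith [sq_nonneg (b - a - (d - c)), sq_nonneg ((b - a) * (d - c))]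
      have h6 : (b - a) * (d - c) * (c - b) ^ (2 * H - 2) ≤
        (1 + (b - a) ^ 2) * (1 + (d - c) ^ 2) * (ℓ / 2) ^ (2 * H - 2) :=
        mul_le_mul h5 h4 (Real.rpow_nonneg (by linarith) _) (by positivity)
      have h7 : 0 ≤ (1 + (b - a) ^ 2) * (1 + (d - c) ^ 2) * (ℓ / 2) ^ (2 * H - 2) := by positivity
      linarith
    · -- a long increment: trade its length for decay in `ℓ`
      have h3 : (b - a) ^ (2 * H) = (b - a) ^ 2 * (b - a) ^ (2 * H - 2) := by
        rw [← Real.rpow_two, ← Real.rpow_add (by linarith)]; ring_nf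
      have h4 : (b - a) ^ (2 * H - 2) ≤ (ℓ / 2) ^ (2 * H - 2) :=
        Real.rpow_le_rpow_of_nonpos (by linarith) h2.le (by linarith)
      have h5 : (b - a) ^ 2 * (b - a) ^ (2 * H - 2) ≤
          2 * ((1 + (b - a) ^ 2) * (1 + (d - c) ^ 2)) * (ℓ / 2) ^ (2 * H - 2) := by
        gcongr
        linarith [sq_nonneg (b - a)]
      linarith

/-! ### Comparison of the noise with fractional Brownian motion -/

lemma CenteredGaussianProcess.cov_comm {Ω : Type*} [MeasurableSpace Ω] {P : Measure Ω}
    (G : CenteredGaussianProcess P) (t s : ℝ) : G.cov t s = G.cov s t := by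
  simp only [CenteredGaussianProcess.cov, mul_comm]

lemma continuous_fbmCov_left {H : ℝ} (hH : 0 < H) (s : ℝ) : Continuous fun t => fbmCov H t s := by
  unfold fbmCov
  have h1 : Continuous fun t : ℝ => t ^ (2 * H) := Real.continuous_rpow_const (by linarith)
  have h2 : Continuous fun t : ℝ => |t - s| ^ (2 * H) := h1.comp (by fun_prop)
  fun_prop

lemma differentiableAt_fbmCov_left (H : ℝ) {s t : ℝ} (ht : t ≠ 0) (hts : t ≠ s) :
    DifferentiableAt ℝ (fun t => fbmCov H t s) t := by
  unfold fbmCov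
  have h1 : DifferentiableAt ℝ (fun t : ℝ => t ^ (2 * H)) t :=
    Real.differentiableAt_rpow_const_of_ne _ ht
  have h2 : DifferentiableAt ℝ (fun t : ℝ => |t - s| ^ (2 * H)) t := by
    have h3 : DifferentiableAt ℝ (fun t : ℝ => |t - s|) t :=
      (differentiableAt_abs (sub_ne_zero.2 hts)).comp (f := fun t => t - s) t (by fun_prop)
    exact h3.rpow_const (Or.inl (abs_ne_zero.2 (sub_ne_zero.2 hts)))
  fun_prop

lemma hasDerivAt_const_mul_rpow (k : ℝ) {H t : ℝ} (ht : t ≠ 0) :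
    HasDerivAt (fun t : ℝ => k * t ^ H) (k * (H * t ^ (H - 1))) t :=
  (Real.hasDerivAt_rpow_const (Or.inl ht)).const_mul k

section Noise

variable {R : ℝ → ℝ → ℝ} {H C' : ℝ}

lemma NoiseHypothesis.differentiableAt (h : NoiseHypothesis R H C') (hR : ∀ t s, R t s = R s t)
    {s t : ℝ} (hs : 0 ≤ s) (ht : 0 < t) (hts : t ≠ s) :
    DifferentiableAt ℝ (fun t => R t s) t := by
  rcases hs.eq_or_lt with rfl | hs
  · have : (fun t => R t 0) =ᶠ[𝓝 t] fun _ => 0 := by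
      filter_upwards [lt_mem_nhds ht] with u hu
      rw [hR, h.zero_left u hu.le]
    exact (differentiableAt_const (0 : ℝ)).congr_of_eventuallyEq this
  · refine h.differentiableAt_left (s + t + 1) s ⟨hs, by linarith⟩ t ?_
    rcases lt_or_gt_of_ne hts with h' | h'
    · exact Or.inl ⟨ht, h'⟩
    · exact Or.inr ⟨h', by linarith⟩

/-- The increments in `s` of `∂R/∂t - ∂R^B/∂t`: integration of the bound on `Ψ(t, ·)`. -/
lemma NoiseHypothesis.abs_deriv_sub_le (h : NoiseHypothesis R H C') (hH : 0 < H)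
    {c d t : ℝ} (hc : 0 ≤ c) (hcd : c ≤ d) (ht : 0 < t) (htc : t ≠ c) (htd : t ≠ d) :
    |(deriv (fun t' => R t' d) t - deriv (fun t' => fbmCov H t' d) t) -
      (deriv (fun t' => R t' c) t - deriv (fun t' => fbmCov H t' c) t)| ≤
      C' * t ^ (H - 1) / H * (d ^ H - c ^ H) := by
  obtain ⟨D, hD, hDc, hD'⟩ := h.mixed_deriv_bound (d + t + 1) t ⟨ht, by linarith⟩
  have hsub : Icc c d ⊆ Icc 0 (d + t + 1) := Icc_subset_Icc hc (by linarith)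
  have hsub' : Ioo c d ⊆ Ioo 0 (d + t + 1) := Ioo_subset_Ioo hc (by linarith)
  rw [← hD d (hsub (right_mem_Icc.2 hcd)) htd.symm, ← hD c (hsub (left_mem_Icc.2 hcd)) htc.symm,
    mul_sub]
  refine abs_sub_le_of_abs_deriv_le (m := fun s => C' * t ^ (H - 1) / H * s ^ H) hcd
    (hDc.mono hsub) ((Real.continuous_rpow_const hH.le).const_mul _).continuousOn
    (fun s hs => (hD' s (hsub' hs)).1)
    (fun s hs => (hasDerivAt_const_mul_rpow _ (hsub' hs).1.ne').differentiableAt) fun s hs => ?_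
  rw [(hasDerivAt_const_mul_rpow _ (hsub' hs).1.ne').deriv]
  refine (hD' s (hsub' hs)).2.trans (le_of_eq ?_)
  have hs0 : 0 < s := (hsub' hs).1
  rw [abs_of_pos (mul_pos ht hs0), Real.mul_rpow ht.le hs0.le]
  field_simp

/-- The rectangular increments of `R - R^B` are bounded by those of `C' H⁻² t^H s^H`. -/
lemma NoiseHypothesis.abs_rectInc_sub_le (h : NoiseHypothesis R H C')
    (hR : ∀ t s, R t s = R s t) (hH : 0 < H) {a b c d : ℝ} (ha : 0 ≤ a) (hab : a ≤ b)
    (hc : 0 ≤ c) (hcd : c ≤ d) :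
    |rectInc R a b c d - rectInc (fbmCov H) a b c d| ≤
      C' / H ^ 2 * ((b ^ H - a ^ H) * (d ^ H - c ^ H)) := by
  have hd : 0 ≤ d := hc.trans hcd
  set q : ℝ → ℝ := fun t => (R t d - fbmCov H t d) - (R t c - fbmCov H t c) with hq
  have hcont : ∀ s, 0 ≤ s → ContinuousOn (fun t => R t s) (Icc a b) := fun s hs =>
    h.continuous.comp (f := fun t => (t, s)) (by fun_prop)
      fun t ht => ⟨ha.trans ht.1, hs⟩
  have hcq : ContinuousOn q (Icc a b) :=
    ((hcont d hd).sub (continuous_fbmCov_left hH d).continuousOn).sub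
      ((hcont c hc).sub (continuous_fbmCov_left hH c).continuousOn)
  have hdq : ∀ t ∈ Ioo a b, t ≠ c → t ≠ d → HasDerivAt q
      ((deriv (fun t' => R t' d) t - deriv (fun t' => fbmCov H t' d) t) -
      (deriv (fun t' => R t' c) t - deriv (fun t' => fbmCov H t' c) t)) t := by
    intro t ht htc htd
    have ht0 : 0 < t := ha.trans_lt ht.1
    exact ((h.differentiableAt hR hd ht0 htd).hasDerivAt.fun_sub
      (differentiableAt_fbmCov_left H ht0.ne' htd).hasDerivAt).fun_sub
      ((h.differentiableAt hR hc ht0 htc).hasDerivAt.fun_sub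
      (differentiableAt_fbmCov_left H ht0.ne' htc).hasDerivAt)
  have key := abs_sub_le_of_abs_deriv_le_of_ne_of_ne (f := q)
    (m := fun t => C' / H ^ 2 * (d ^ H - c ^ H) * t ^ H) c d hab hcq
    ((Real.continuous_rpow_const hH.le).const_mul _).continuousOn
    (fun t ht htc htd => (hdq t ht htc htd).differentiableAt)
    (fun t ht => (hasDerivAt_const_mul_rpow _ (ha.trans_lt ht.1).ne').differentiableAt)
    fun t ht htc htd => by
      rw [(hdq t ht htc htd).deriv, (hasDerivAt_const_mul_rpow _ (ha.trans_lt ht.1).ne').deriv]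
      refine (h.abs_deriv_sub_le hH hc hcd (ha.trans_lt ht.1) htc htd).trans (le_of_eq ?_)
      field_simp
  have e : rectInc R a b c d - rectInc (fbmCov H) a b c d = q b - q a := by
    simp only [rectInc, hq]; ring
  rw [e]
  refine key.trans (le_of_eq ?_)
  ring

/-- The constant in the bound on the rectangular increments of the covariance. -/
noncomputable def incConst (H C' : ℝ) : ℝ := 32 + 16 * (C' / H ^ 2)

lemma incConst_nonneg (hC' : 0 ≤ C') : 0 ≤ incConst H C' := by
  unfold incConst; positivity

/-- The correlation of two increments of the noise: a stationary part with integrable decay, and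
a product of square-integrable functions. -/
lemma NoiseHypothesis.abs_rectInc_le (h : NoiseHypothesis R H C') (hR : ∀ t s, R t s = R s t)
    (hH : 0 < H) (hH' : H ≤ 1 / 2) (hC' : 0 ≤ C') {a b c d : ℝ} (ha : 0 ≤ a) (hab : a ≤ b)
    (hc : 0 ≤ c) (hcd : c ≤ d) :
    |rectInc R a b c d| ≤ incConst H C' * ((1 + (b - a) ^ 2) * (1 + (d - c) ^ 2)) *
      ((1 + |a - c|) ^ (2 * H - 2) + (1 + a) ^ (H - 1) * (1 + c) ^ (H - 1)) := by
  have h1 := h.abs_rectInc_sub_le hR hH ha hab hc hcd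
  have h2 := abs_rectInc_fbmCov_le hH hH' hab hcd
  have h3 := rpow_sub_rpow_le hH (by linarith) ha hab
  have h4 := rpow_sub_rpow_le hH (by linarith) hc hcd
  have h5 : 0 ≤ d ^ H - c ^ H := sub_nonneg.2 (Real.rpow_le_rpow hc hcd hH.le)
  have h6 : (b ^ H - a ^ H) * (d ^ H - c ^ H) ≤ 4 * (1 + (b - a) ^ 2) * (1 + a) ^ (H - 1) *
      (4 * (1 + (d - c) ^ 2) * (1 + c) ^ (H - 1)) := by gcongr
  have hk : 0 ≤ C' / H ^ 2 := by positivity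
  have h7 := mul_le_mul_of_nonneg_left h6 hk
  have hj : 0 ≤ (1 + |a - c|) ^ (2 * H - 2) := by positivity
  have hw : 0 ≤ (1 + a) ^ (H - 1) * (1 + c) ^ (H - 1) := by positivity
  have hN : 0 ≤ (1 + (b - a) ^ 2) * (1 + (d - c) ^ 2) := by positivity
  have h8 : |rectInc R a b c d| ≤ |rectInc R a b c d - rectInc (fbmCov H) a b c d| +
      |rectInc (fbmCov H) a b c d| := by
    have := abs_add_le (rectInc R a b c d - rectInc (fbmCov H) a b c d)
      (rectInc (fbmCov H) a b c d)
    rwa [sub_add_cancel] at this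
  refine (h8.trans (add_le_add (h1.trans h7) h2)).trans ?_
  unfold incConst
  have i1 := mul_nonneg (mul_nonneg hk hN) hj
  have i2 := mul_nonneg hN hw
  linarith

end Noise

/-! ### Contractions of integrals of squares -/

section SquareIntegral

variable {E : Type*} [NormedAddCommGroup E] [InnerProductSpace ℝ E]

/-- The elementary tensors are total in `E^{⊗2}`. -/
lemma HTensor.ext_inner {x y : HTensor E}
    (h : ∀ a b : E, inner ℝ x (htmul a b) = inner ℝ y (htmul a b)) : x = y := by
  refine ext_inner_right ℝ fun z => ?_
  induction z using UniformSpace.Completion.induction_on with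
  | hp => exact isClosed_eq (by fun_prop) (by fun_prop)
  | ih z =>
    induction z using TensorProduct.induction_on with
    | zero => rw [UniformSpace.Completion.coe_zero, inner_zero_right, inner_zero_right]
    | tmul a b => exact h a b
    | add z w hz hw => rw [UniformSpace.Completion.coe_add, inner_add_right, inner_add_right, hz, hw]

lemma htmul_sub_htmul (x y x' y' : E) :
    htmul x y - htmul x' y' = htmul (x - x') y + htmul x' (y - y') := by
  simp only [htmul, TensorProduct.sub_tmul, TensorProduct.tmul_sub,
    UniformSpace.Completion.coe_sub]
  abel

lemma continuous_htmul : Continuous fun p : E × E => htmul p.1 p.2 := by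
  refine continuous_iff_continuousAt.2 fun ⟨x, y⟩ => ?_
  refine tendsto_iff_norm_sub_tendsto_zero.2 ?_
  have h : Tendsto (fun p : E × E => ‖p.1 - x‖ * ‖p.2‖ + ‖x‖ * ‖p.2 - y‖) (𝓝 (x, y)) (𝓝 0) := by
    have hc : Continuous fun p : E × E => ‖p.1 - x‖ * ‖p.2‖ + ‖x‖ * ‖p.2 - y‖ := by fun_prop
    simpa using hc.tendsto (x, y)
  refine squeeze_zero (fun _ => norm_nonneg _) (fun p => ?_) h
  rw [htmul_sub_htmul]
  refine (norm_add_le _ _).trans_eq ?_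
  rw [norm_htmul, norm_htmul]

variable {α : Type*} [MeasurableSpace α] {ν : Measure α} [IsFiniteMeasure ν]
  {X : α → E} {M : ℝ}

lemma integrable_htmul {Y : α → E} {N : ℝ} (hX : StronglyMeasurable X) (hY : StronglyMeasurable Y)
    (hM : ∀ r, ‖X r‖ ≤ M) (hN : ∀ r, ‖Y r‖ ≤ N) : Integrable (fun r => htmul (X r) (Y r)) ν := by
  refine Integrable.of_bound (continuous_htmul.comp_stronglyMeasurable
    (hX.prodMk hY)).aestronglyMeasurable (M * N) (ae_of_all _ fun r => ?_)
  rw [norm_htmul]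
  exact mul_le_mul (hM r) (hN r) (norm_nonneg _) ((norm_nonneg _).trans (hM r))

lemma integrable_inner_smul (hX : StronglyMeasurable X) (hM : ∀ r, ‖X r‖ ≤ M) (y : E) :
    Integrable (fun r => inner ℝ (X r) y • X r) ν := by
  refine Integrable.of_bound ((hX.inner stronglyMeasurable_const).smul hX).aestronglyMeasurable
    (M * ‖y‖ * M) (ae_of_all _ fun r => ?_)
  rw [norm_smul]
  have h0 : 0 ≤ M := (norm_nonneg _).trans (hM r)
  refine mul_le_mul ?_ (hM r) (norm_nonneg _) (by positivity)
  exact (norm_inner_le_norm _ _).trans (mul_le_mul_of_nonneg_right (hM r) (norm_nonneg _))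

/-- The operator `y ↦ ∫ ⟨X_r, y⟩ X_r dν(r)`, of which `∫ X_r ⊗ X_r dν(r)` is the kernel. -/
noncomputable def squareOp (ν : Measure α) (X : α → E) (y : E) : E :=
  ∫ r, inner ℝ (X r) y • X r ∂ν

lemma norm_squareOp_le (hM : ∀ r, ‖X r‖ ≤ M) (y : E) :
    ‖squareOp ν X y‖ ≤ M * ‖y‖ * M * ν.real univ := by
  refine norm_integral_le_of_norm_le_const (ae_of_all _ fun r => ?_)
  rw [norm_smul]
  have h0 : 0 ≤ M := (norm_nonneg _).trans (hM r)
  refine mul_le_mul ?_ (hM r) (norm_nonneg _) (by positivity)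
  exact (norm_inner_le_norm _ _).trans (mul_le_mul_of_nonneg_right (hM r) (norm_nonneg _))

lemma squareOp_sub (hX : StronglyMeasurable X) (hM : ∀ r, ‖X r‖ ≤ M) (x y : E) :
    squareOp ν X (x - y) = squareOp ν X x - squareOp ν X y := by
  rw [squareOp, squareOp, squareOp, ← integral_sub (integrable_inner_smul hX hM x)
    (integrable_inner_smul hX hM y)]
  simp only [inner_sub_right, sub_smul]

lemma continuous_squareOp (hX : StronglyMeasurable X) (hM : ∀ r, ‖X r‖ ≤ M) :
    Continuous (squareOp ν X) := by
  refine LipschitzWith.continuous (K := (M * M * ν.real univ).toNNReal)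
    (LipschitzWith.of_dist_le_mul fun x y => ?_)
  rw [dist_eq_norm, dist_eq_norm, ← squareOp_sub hX hM,
    Real.coe_toNNReal _ (mul_nonneg (mul_self_nonneg M) measureReal_nonneg)]
  refine (norm_squareOp_le hM _).trans_eq ?_
  ring

lemma stronglyMeasurable_squareOp (hX : StronglyMeasurable X) (hM : ∀ r, ‖X r‖ ≤ M) :
    StronglyMeasurable fun r => squareOp ν X (X r) :=
  (continuous_squareOp hX hM).comp_stronglyMeasurable hX

lemma norm_squareOp_apply_le (hM : ∀ r, ‖X r‖ ≤ M) (r : α) :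
    ‖squareOp ν X (X r)‖ ≤ M * M * M * ν.real univ := by
  have h0 : 0 ≤ M := (norm_nonneg _).trans (hM r)
  refine (norm_squareOp_le hM _).trans ?_
  gcongr
  exact hM r

variable [CompleteSpace E]

lemma inner_squareOp (hX : StronglyMeasurable X) (hM : ∀ r, ‖X r‖ ≤ M) (x y : E) :
    inner ℝ x (squareOp ν X y) = ∫ r, inner ℝ (X r) x * inner ℝ (X r) y ∂ν := by
  rw [squareOp, ← integral_inner (integrable_inner_smul hX hM y)]
  refine integral_congr_ae (ae_of_all _ fun r => ?_)
  simp only [inner_smul_right, real_inner_comm (X r) x]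
  ring

lemma inner_squareOp_comm (hX : StronglyMeasurable X) (hM : ∀ r, ‖X r‖ ≤ M) (x y : E) :
    inner ℝ x (squareOp ν X y) = inner ℝ (squareOp ν X x) y := by
  rw [real_inner_comm y, inner_squareOp hX hM, inner_squareOp hX hM]
  simp only [mul_comm]

lemma partialInner_integral_htmul (hX : StronglyMeasurable X) (hM : ∀ r, ‖X r‖ ≤ M) (y : E) :
    partialInner (∫ r, htmul (X r) (X r) ∂ν) y = squareOp ν X y := by
  refine ext_inner_right ℝ fun x => ?_
  rw [inner_partialInner, real_inner_comm, ← integral_inner (integrable_htmul hX hX hM hM),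
    real_inner_comm, inner_squareOp hX hM]
  simp only [real_inner_comm _ (htmul x y), inner_htmul]

/-- If `A` is the symmetric operator with kernel `F`, then `A²` has kernel `F ⊗₁ F`. -/
lemma inner_contraction_integral_htmul {ι : Type*} (e : HilbertBasis ι ℝ E)
    (hX : StronglyMeasurable X) (hM : ∀ r, ‖X r‖ ≤ M) (x y : E) :
    inner ℝ (contraction e (∫ r, htmul (X r) (X r) ∂ν) (∫ r, htmul (X r) (X r) ∂ν)) (htmul x y) =
      inner ℝ (squareOp ν X x) (squareOp ν X y) := by
  have h1 : HasSum (fun i => inner ℝ (htmul x y) (htmul (squareOp ν X (e i)) (squareOp ν X (e i))))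
      (inner ℝ (htmul x y) (contraction e (∫ r, htmul (X r) (X r) ∂ν)
        (∫ r, htmul (X r) (X r) ∂ν))) := by
    have := (summable_contraction e (∫ r, htmul (X r) (X r) ∂ν)
      (∫ r, htmul (X r) (X r) ∂ν)).hasSum.mapL (innerSL ℝ (htmul x y))
    simpa only [innerSL_apply_apply, contraction, partialInner_integral_htmul hX hM] using this
  have h2 := e.hasSum_inner_mul_inner (squareOp ν X x) (squareOp ν X y)
  rw [real_inner_comm]
  refine h1.unique (h2.congr_fun fun i => ?_)
  rw [inner_htmul, inner_squareOp_comm hX hM, inner_squareOp_comm hX hM,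
    real_inner_comm (squareOp ν X y) (e i)]

/-- Contracting `F = ∫ X_r ⊗ X_r dν(r)` with itself applies the operator `A` with kernel `F` to one
of the two factors. -/
lemma contraction_integral_htmul {ι : Type*} (e : HilbertBasis ι ℝ E)
    (hX : StronglyMeasurable X) (hM : ∀ r, ‖X r‖ ≤ M) :
    contraction e (∫ r, htmul (X r) (X r) ∂ν) (∫ r, htmul (X r) (X r) ∂ν) =
      ∫ r, htmul (squareOp ν X (X r)) (X r) ∂ν := by
  refine HTensor.ext_inner fun x y => ?_
  rw [inner_contraction_integral_htmul e hX hM, real_inner_comm,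
    real_inner_comm (htmul x y), ← integral_inner (integrable_htmul
      (stronglyMeasurable_squareOp hX hM) hX (norm_squareOp_apply_le hM) hM),
    real_inner_comm, inner_squareOp hX hM]
  refine integral_congr_ae (ae_of_all _ fun r => ?_)
  simp only [inner_htmul]
  rw [inner_squareOp_comm hX hM x (X r), real_inner_comm (squareOp ν X x) (X r),
    real_inner_comm y]

/-- The squared norm of `F ⊗₁ F` for `F = ∫ X_r ⊗ X_r dν(r)` is the squared Hilbert–Schmidt norm
of the square of the covariance kernel `⟨X_r, X_s⟩` on `L²(ν)`. -/
lemma norm_sq_contraction_integral_htmul {ι : Type*} (e : HilbertBasis ι ℝ E)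
    (hX : StronglyMeasurable X) (hM : ∀ r, ‖X r‖ ≤ M) :
    ‖contraction e (∫ r, htmul (X r) (X r) ∂ν) (∫ r, htmul (X r) (X r) ∂ν)‖ ^ 2 =
      ∫ s, ∫ r, (∫ u, inner ℝ (X u) (X r) * inner ℝ (X u) (X s) ∂ν) ^ 2 ∂ν ∂ν := by
  set C := contraction e (∫ r, htmul (X r) (X r) ∂ν) (∫ r, htmul (X r) (X r) ∂ν) with hC
  have h1 : ‖C‖ ^ 2 = inner ℝ C (∫ r, htmul (squareOp ν X (X r)) (X r) ∂ν) := by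
    rw [← contraction_integral_htmul e hX hM, ← hC, real_inner_self_eq_norm_sq]
  rw [h1, ← integral_inner (integrable_htmul
      (stronglyMeasurable_squareOp hX hM) hX (norm_squareOp_apply_le hM) hM)]
  refine integral_congr_ae (ae_of_all _ fun s => ?_)
  simp only
  rw [hC, inner_contraction_integral_htmul e hX hM, real_inner_comm, inner_squareOp hX hM]
  refine integral_congr_ae (ae_of_all _ fun r => ?_)
  simp only
  rw [inner_squareOp hX hM, sq]

end SquareIntegral

/-! ### Composition of kernels with polynomial decay -/

/-- The stationary decay `(1 + |x|)^{2H-2}`, integrable for `H < 1/2`. -/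
noncomputable def decay (H x : ℝ) : ℝ := (1 + |x|) ^ (2 * H - 2)

/-- The weight `(1 + |x|)^{H-1}`, the square root of `decay`. -/
noncomputable def weight (H x : ℝ) : ℝ := (1 + |x|) ^ (H - 1)

lemma decay_pos (H x : ℝ) : 0 < decay H x := by unfold decay; positivity

lemma weight_pos (H x : ℝ) : 0 < weight H x := by unfold weight; positivity

lemma decay_le_one {H : ℝ} (hH : H ≤ 1) (x : ℝ) : decay H x ≤ 1 :=
  Real.rpow_le_one_of_one_le_of_nonpos (by linarith [abs_nonneg x]) (by linarith)

lemma weight_le_one {H : ℝ} (hH : H ≤ 1) (x : ℝ) : weight H x ≤ 1 :=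
  Real.rpow_le_one_of_one_le_of_nonpos (by linarith [abs_nonneg x]) (by linarith)

lemma weight_sq (H x : ℝ) : weight H x ^ 2 = decay H (x - 0) := by
  rw [weight, decay, sub_zero, ← Real.rpow_natCast, ← Real.rpow_mul (by positivity)]
  congr 1
  push_cast
  ring

lemma continuous_decay (H : ℝ) : Continuous (decay H) := by
  unfold decay
  refine Continuous.rpow_const (by fun_prop) fun x => Or.inl ?_
  positivity

lemma decay_sub_comm (H x y : ℝ) : decay H (x - y) = decay H (y - x) := by
  rw [decay, abs_sub_comm, decay]

/-- One of two consecutive displacements is at least half the total one. -/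
lemma decay_mul_decay_le {H : ℝ} (hH0 : 0 ≤ H) (hH : H ≤ 1) (r s u : ℝ) :
    decay H (u - r) * decay H (u - s) ≤
      4 * decay H (r - s) * (decay H (u - r) + decay H (u - s)) := by
  have key : ∀ x y : ℝ, |x - y| ≤ 2 * |x| + 1 → decay H x ≤ 4 * decay H (x - y) := by
    intro x y h
    refine (Real.rpow_le_rpow_of_nonpos (by positivity)
      (show (1 + |x - y|) / 2 ≤ 1 + |x| by linarith) (by linarith)).trans ?_
    exact rpow_half_le (by positivity) (by linarith)
  have h0 := (decay_pos H (u - r)).le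
  have h1 := (decay_pos H (u - s)).le
  have h2 := (decay_pos H (r - s)).le
  have ht := abs_sub (u - s) (u - r)
  rw [show u - s - (u - r) = r - s by ring] at ht
  rcases le_total |u - s| |u - r| with h | h
  · have h3 := key (u - r) (u - s) (by
      rw [show u - r - (u - s) = -(r - s) by ring, abs_neg]; linarith)
    rw [show u - r - (u - s) = s - r by ring, decay_sub_comm H s r] at h3
    nlinarith [mul_nonneg h2 h0]
  · have h3 := key (u - s) (u - r) (by rw [show u - s - (u - r) = r - s by ring]; linarith)
    rw [show u - s - (u - r) = r - s by ring] at h3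
    nlinarith [mul_nonneg h2 h1]

section Kernel

variable {ν : Measure ℝ} [IsFiniteMeasure ν] {H J A : ℝ} {K : ℝ → ℝ → ℝ} {S : Set ℝ}

lemma integrable_decay_sub (hH : H ≤ 1) (r : ℝ) : Integrable (fun u => decay H (u - r)) ν :=
  Integrable.of_bound ((continuous_decay H).comp (by fun_prop)).aestronglyMeasurable 1
    (ae_of_all _ fun u => by
      rw [Real.norm_of_nonneg (decay_pos _ _).le]
      exact decay_le_one hH _)

lemma integral_decay_add_le (hH : H ≤ 1) (hJ : ∀ r, ∫ u, decay H (u - r) ∂ν ≤ J)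
    {a b c : ℝ} (ha : 0 ≤ a) (hb : 0 ≤ b) (hc : 0 ≤ c) (r s t : ℝ) :
    ∫ u, (a * decay H (u - r) + b * decay H (u - s) + c * decay H (u - t)) ∂ν ≤
      (a + b + c) * J := by
  have h1 := (integrable_decay_sub (ν := ν) hH r).const_mul a
  have h2 := (integrable_decay_sub (ν := ν) hH s).const_mul b
  have h3 := (integrable_decay_sub (ν := ν) hH t).const_mul c
  rw [integral_add (f := fun u => a * decay H (u - r) + b * decay H (u - s)) (h1.add h2) h3,
    integral_add h1 h2, integral_const_mul, integral_const_mul,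
    integral_const_mul]
  have := mul_le_mul_of_nonneg_left (hJ r) ha
  have := mul_le_mul_of_nonneg_left (hJ s) hb
  have := mul_le_mul_of_nonneg_left (hJ t) hc
  linarith

/-- The composition square of the kernel `K`, pointwise. The constant is not optimized. -/
lemma abs_integral_kernel_mul_le (hH0 : 0 ≤ H) (hH : H ≤ 1)
    (hJ : ∀ r, ∫ u, decay H (u - r) ∂ν ≤ J) (hA : 0 ≤ A) (hS : ∀ᵐ r ∂ν, r ∈ S)
    (hK : ∀ r ∈ S, ∀ s ∈ S, |K r s| ≤ A * (decay H (r - s) + weight H r * weight H s))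
    {r s : ℝ} (hr : r ∈ S) (hs : s ∈ S) :
    |∫ u, K u r * K u s ∂ν| ≤ 8 * A ^ 2 * J * (decay H (r - s) + weight H r + weight H s) := by
  have hJ0 : 0 ≤ J := (integral_nonneg fun u => (decay_pos H (u - r)).le).trans (hJ r)
  have h1 := (decay_pos H (r - s)).le
  have h2 := (weight_pos H r).le
  have h3 := (weight_pos H s).le
  have hA2 := sq_nonneg A
  set a := A ^ 2 * (4 * decay H (r - s) + weight H s) with ha
  set b := A ^ 2 * (4 * decay H (r - s) + weight H r) with hb
  set c := A ^ 2 * weight H r with hc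
  have key : ∀ᵐ u ∂ν, ‖K u r * K u s‖ ≤
      a * decay H (u - r) + b * decay H (u - s) + c * decay H (u - 0) := by
    filter_upwards [hS] with u hu
    have k1 := hK u hu r hr
    have k2 := hK u hu s hs
    have d1 := (decay_pos H (u - r)).le
    have d2 := (decay_pos H (u - s)).le
    have d3 := decay_mul_decay_le hH0 hH r s u
    have d4 := weight_sq H u
    have w0 := (weight_pos H u).le
    have w1 := weight_le_one hH u
    have w2 := weight_le_one hH s
    rw [Real.norm_eq_abs, abs_mul]
    calc |K u r| * |K u s| ≤ (A * (decay H (u - r) + weight H u * weight H r)) *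
          (A * (decay H (u - s) + weight H u * weight H s)) := by gcongr
      _ = A ^ 2 * (decay H (u - r) * decay H (u - s) + weight H u * (weight H s * decay H (u - r)) +
          weight H u * (weight H r * decay H (u - s)) +
          weight H u ^ 2 * (weight H r * weight H s)) := by ring
      _ ≤ A ^ 2 * (4 * decay H (r - s) * (decay H (u - r) + decay H (u - s)) +
          1 * (weight H s * decay H (u - r)) + 1 * (weight H r * decay H (u - s)) +
          decay H (u - 0) * (weight H r * 1)) := by
        rw [d4]
        have d5 := (decay_pos H (u - 0)).le
        gcongr
      _ = _ := by rw [ha, hb, hc]; ring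
  have hint : Integrable (fun u => a * decay H (u - r) + b * decay H (u - s) +
      c * decay H (u - 0)) ν :=
    (((integrable_decay_sub hH r).const_mul a).add ((integrable_decay_sub hH s).const_mul b)).add
      ((integrable_decay_sub hH 0).const_mul c)
  have := (norm_integral_le_of_norm_le hint key).trans (integral_decay_add_le hH hJ
    (by positivity) (by positivity) (by positivity) r s 0)
  refine (this.trans ?_)
  have e : 0 ≤ A ^ 2 * J * (6 * weight H r + 7 * weight H s) := by positivity
  rw [ha, hb, hc]
  linarith

/-- The Hilbert–Schmidt norm of the composition square of a kernel dominated by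
`decay (r - s) + weight r * weight s` grows at most like the square root of the total mass. -/
lemma integral_integral_sq_le (hH0 : 0 ≤ H) (hH : H ≤ 1)
    (hJ : ∀ r, ∫ u, decay H (u - r) ∂ν ≤ J) (hA : 0 ≤ A) (hS : ∀ᵐ r ∂ν, r ∈ S)
    (hK : ∀ r ∈ S, ∀ s ∈ S, |K r s| ≤ A * (decay H (r - s) + weight H r * weight H s)) :
    ∫ s, ∫ r, (∫ u, K u r * K u s ∂ν) ^ 2 ∂ν ∂ν ≤ 576 * A ^ 4 * J ^ 3 * ν.real univ := by
  have hJ0 : 0 ≤ J := (integral_nonneg fun u => (decay_pos H (u - 0)).le).trans (hJ 0)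
  set B := 192 * A ^ 4 * J ^ 2 with hB
  have hB0 : 0 ≤ B := by positivity
  have h1 : ∀ s ∈ S, ∫ r, (∫ u, K u r * K u s ∂ν) ^ 2 ∂ν ≤
      2 * (B * J) + B * ν.real univ * decay H (s - 0) := by
    intro s hs
    have hint : Integrable (fun r => B * decay H (r - s) + B * decay H (r - 0)
      + 0 * decay H (r - 0)) ν :=
      (((integrable_decay_sub hH s).const_mul B).add
        ((integrable_decay_sub hH 0).const_mul B)).add ((integrable_decay_sub hH 0).const_mul 0)
    have h2 : ∫ r, (∫ u, K u r * K u s ∂ν) ^ 2 ∂ν ≤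
        ∫ r, ((B * decay H (r - s) + B * decay H (r - 0) + 0 * decay H (r - 0))
          + B * decay H (s - 0)) ∂ν := by
      refine integral_mono_of_nonneg (ae_of_all _ fun r => sq_nonneg _)
        (hint.add (integrable_const _)) ?_
      filter_upwards [hS] with r hr
      have h3 := abs_integral_kernel_mul_le hH0 hH hJ hA hS hK hr hs
      have h4 := (decay_pos H (r - s)).le
      have h5 := (weight_pos H r).le
      have h6 := (weight_pos H s).le
      have h7 : decay H (r - s) ^ 2 ≤ decay H (r - s) := by
        nlinarith [decay_le_one hH (r - s)]
      calc (∫ u, K u r * K u s ∂ν) ^ 2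
          ≤ (8 * A ^ 2 * J * (decay H (r - s) + weight H r + weight H s)) ^ 2 :=
            sq_le_sq' (by linarith [(abs_le.1 h3).1]) (abs_le.1 h3).2
        _ = 64 * A ^ 4 * J ^ 2 * (decay H (r - s) + weight H r + weight H s) ^ 2 := by ring
        _ ≤ 64 * A ^ 4 * J ^ 2 *
            (3 * (decay H (r - s) + decay H (r - 0) + decay H (s - 0))) := by
          gcongr
          rw [← weight_sq, ← weight_sq]
          nlinarith [sq_nonneg (decay H (r - s) - weight H r),
            sq_nonneg (decay H (r - s) - weight H s), sq_nonneg (weight H r - weight H s)]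
        _ = _ := by rw [hB]; ring
    refine h2.trans ?_
    rw [integral_add hint (integrable_const _), integral_const, smul_eq_mul]
    have := integral_decay_add_le hH hJ hB0 hB0 le_rfl s 0 0
    linarith
  have h2 : ∫ s, ∫ r, (∫ u, K u r * K u s ∂ν) ^ 2 ∂ν ∂ν ≤
      ∫ s, (2 * (B * J) + B * ν.real univ * decay H (s - 0)) ∂ν := by
    refine integral_mono_of_nonneg
      (ae_of_all _ fun s => integral_nonneg fun r => sq_nonneg _)
      ((integrable_const _).add ((integrable_decay_sub hH 0).const_mul _)) ?_
    filter_upwards [hS] with s hs using h1 s hs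
  refine h2.trans ?_
  rw [integral_add (integrable_const _) ((integrable_decay_sub hH 0).const_mul _), integral_const,
    integral_const_mul, smul_eq_mul]
  have h3 : B * ν.real univ * ∫ s, decay H (s - 0) ∂ν ≤ B * ν.real univ * J :=
    mul_le_mul_of_nonneg_left (hJ 0) (mul_nonneg hB0 measureReal_nonneg)
  refine (add_le_add_right h3 _).trans (le_of_eq ?_)
  rw [hB]
  ring

end Kernel

/-! ### The mixing measure and the exponential law -/

/-- The measure `ν = δ₀ + 2θ dr` on `[0,T]`, for which
`e^{-θ|t-s|} = ∫ 1_{r ≤ t} e^{-θ(t-r)} 1_{r ≤ s} e^{-θ(s-r)} dν(r)`. -/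
noncomputable def mixMeasure (θ T : ℝ) : Measure ℝ :=
  Measure.dirac 0 + ENNReal.ofReal (2 * θ) • volume.restrict (Icc 0 T)

instance (θ T : ℝ) : IsFiniteMeasure (mixMeasure θ T) := by
  unfold mixMeasure
  have : IsFiniteMeasure (ENNReal.ofReal (2 * θ) • volume.restrict (Icc 0 T)) :=
    Measure.smul_finite _ ENNReal.ofReal_ne_top
  infer_instance

section MixMeasure

variable {θ T : ℝ}

lemma ae_mem_mixMeasure (hT : 0 ≤ T) : ∀ᵐ r ∂(mixMeasure θ T), r ∈ Icc 0 T := by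
  rw [mixMeasure, ae_add_measure_iff]
  refine ⟨?_, Measure.ae_smul_measure (ae_restrict_mem measurableSet_Icc) _⟩
  exact (ae_dirac_iff (p := fun r => r ∈ Icc 0 T) measurableSet_Icc).2 ⟨le_rfl, hT⟩

lemma integral_mixMeasure (hθ : 0 ≤ θ) {E : Type*} [NormedAddCommGroup E] [NormedSpace ℝ E]
    [CompleteSpace E] {f : ℝ → E} (hf : Integrable f (mixMeasure θ T)) :
    ∫ r, f r ∂(mixMeasure θ T) = f 0 + (2 * θ) • ∫ r in Icc 0 T, f r := by
  rw [mixMeasure] at hf ⊢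
  rw [integral_add_measure hf.left_of_add_measure hf.right_of_add_measure, integral_dirac,
    integral_smul_measure, ENNReal.toReal_ofReal (by positivity)]

lemma mixMeasure_real_univ_le (hθ : 0 ≤ θ) (hT : 1 ≤ T) :
    (mixMeasure θ T).real univ ≤ (1 + 2 * θ) * T := by
  have h := integral_mixMeasure (T := T) hθ (f := fun _ => (1 : ℝ)) (integrable_const _)
  rw [integral_const, integral_const] at h
  simp only [smul_eq_mul, mul_one, measureReal_restrict_apply_univ, Real.volume_real_Icc,
    sub_zero] at h
  rw [h, max_eq_left (by linarith)]
  linarith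

lemma integrable_decay {H : ℝ} (hH : H < 1 / 2) : Integrable (decay H) := by
  have h := integrable_one_add_norm (E := ℝ) (μ := volume) (r := 2 - 2 * H)
    (by rw [Module.finrank_self]; push_cast; linarith)
  refine h.congr (ae_of_all _ fun x => ?_)
  simp only [decay, Real.norm_eq_abs]
  ring_nf

lemma integral_decay_mixMeasure_le {H : ℝ} (hθ : 0 ≤ θ) (hH : H < 1 / 2) (r : ℝ) :
    ∫ u, decay H (u - r) ∂(mixMeasure θ T) ≤ 1 + 2 * θ * ∫ x, decay H x := by
  rw [integral_mixMeasure hθ (integrable_decay_sub (by linarith) r), smul_eq_mul]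
  have h1 : ∫ u in Icc 0 T, decay H (u - r) ≤ ∫ u, decay H (u - r) :=
    setIntegral_le_integral ((integrable_decay hH).comp_sub_right r)
      (ae_of_all _ fun u => (decay_pos H _).le)
  rw [integral_sub_right_eq_self (μ := volume) (decay H) r] at h1
  have := decay_le_one (H := H) (by linarith) (0 - r)
  have : 0 ≤ 2 * θ := by linarith
  gcongr

/-- The mixture representation of the kernel `e^{-θ|t-s|}`. -/
lemma integral_mixMeasure_exp (hθ : 0 < θ) {t s : ℝ} (ht : t ∈ Icc 0 T) (hs : s ∈ Icc 0 T) :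
    ∫ r, (if r ≤ t then Real.exp (-θ * (t - r)) else 0) *
      (if r ≤ s then Real.exp (-θ * (s - r)) else 0) ∂(mixMeasure θ T) =
      Real.exp (-θ * |t - s|) := by
  wlog h : t ≤ s generalizing t s
  · rw [abs_sub_comm, ← this hs ht (le_of_not_ge h)]
    simp only [mul_comm]
  have e1 : ∀ r ∈ Icc 0 T, (if r ≤ t then Real.exp (-θ * (t - r)) else 0) *
      (if r ≤ s then Real.exp (-θ * (s - r)) else 0) =
      (Icc 0 t).indicator (fun r => Real.exp (-θ * (t + s)) * Real.exp (2 * θ * r)) r := by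
    intro r hr
    by_cases hrt : r ≤ t
    · rw [if_pos hrt, if_pos (hrt.trans h), indicator_of_mem (show r ∈ Icc 0 t from ⟨hr.1, hrt⟩),
        ← Real.exp_add, ← Real.exp_add]
      ring_nf
    · rw [if_neg hrt, zero_mul, indicator_of_notMem (show r ∉ Icc 0 t from fun h' => hrt h'.2)]
  have hc : Continuous fun r => Real.exp (-θ * (t + s)) * Real.exp (2 * θ * r) := by fun_prop
  rw [integral_congr_ae ((ae_mem_mixMeasure (ht.1.trans ht.2)).mono e1),
    integral_mixMeasure hθ.le, setIntegral_indicator measurableSet_Icc,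
    inter_eq_self_of_subset_right (Icc_subset_Icc_right ht.2),
    indicator_of_mem (left_mem_Icc.2 ht.1), integral_const_mul, integral_Icc_eq_integral_Ioc,
    ← intervalIntegral.integral_of_le ht.1, smul_eq_mul, mul_left_comm,
    intervalIntegral.mul_integral_comp_mul_left, integral_exp, mul_sub, mul_zero, Real.exp_zero,
    add_sub_cancel, ← Real.exp_add, abs_of_nonpos (sub_nonpos.2 h)]
  · ring_nf
  · refine Integrable.indicator ?_ measurableSet_Icc
    refine Integrable.mono' (g := fun r => Real.exp (-θ * (t + s)) * Real.exp (2 * θ * T))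
      (integrable_const _) hc.aestronglyMeasurable ?_
    filter_upwards [ae_mem_mixMeasure (θ := θ) (ht.1.trans ht.2)] with r hr
    rw [Real.norm_of_nonneg (by positivity)]
    have := hr.2
    gcongr

/-- The exponential law charges `(t, ∞)` with mass `e^{-θt}`. -/
lemma expMeasure_real_Ioi (hθ : 0 < θ) {t : ℝ} (ht : 0 ≤ t) :
    (expMeasure θ).real (Ioi t) = Real.exp (-θ * t) := by
  have := isProbabilityMeasure_expMeasure hθ
  have h := cdf_expMeasure_eq hθ t
  rw [if_pos ht, cdf_eq_real] at h
  rw [← compl_Iic, probReal_compl_eq_one_sub measurableSet_Iic, h]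
  ring_nf

lemma expMeasure_eq_withDensity (θ : ℝ) : expMeasure θ = volume.withDensity (exponentialPDF θ) :=
  rfl

lemma measurable_exponentialPDF (θ : ℝ) : Measurable (exponentialPDF θ) :=
  (measurable_exponentialPDFReal θ).ennreal_ofReal

lemma ae_nonneg_expMeasure (θ : ℝ) : ∀ᵐ v ∂(expMeasure θ), 0 ≤ v := by
  rw [expMeasure_eq_withDensity, ae_withDensity_iff (measurable_exponentialPDF θ)]
  refine ae_of_all _ fun v hv => ?_
  by_contra h
  exact hv (exponentialPDF_of_neg (not_le.1 h))

lemma integrable_one_add_sq_expMeasure (hθ : 0 < θ) :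
    Integrable (fun v => 1 + v ^ 2) (expMeasure θ) := by
  have := isProbabilityMeasure_expMeasure hθ
  refine (integrable_const 1).add ?_
  rw [expMeasure_eq_withDensity, integrable_withDensity_iff (measurable_exponentialPDF θ)
    (ae_of_all _ fun _ => ENNReal.ofReal_lt_top)]
  have h := integrableOn_rpow_mul_exp_neg_mul_rpow (p := 1) (s := 2) (b := θ) (by norm_num)
    one_pos hθ
  rw [← integrableOn_Ici_iff_integrableOn_Ioi] at h
  have h2 := (h.integrable_indicator measurableSet_Ici).const_mul θ
  refine h2.congr (ae_of_all _ fun v => ?_)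
  simp only
  rw [exponentialPDF_eq]
  by_cases hv : 0 ≤ v
  · rw [if_pos hv, indicator_of_mem (show v ∈ Ici 0 from hv), ENNReal.toReal_ofReal (by positivity),
      Real.rpow_one, Real.rpow_two]
    ring_nf
  · rw [if_neg hv, indicator_of_notMem (show v ∉ Ici 0 from hv)]
    simp

end MixMeasure

/-! ### The noise as a curve in `𝔥` -/

/-- The projection of `ℝ` onto `[0,T]`. -/
noncomputable def clip (T t : ℝ) : ℝ := max 0 (min t T)

lemma clip_mem {T : ℝ} (hT : 0 ≤ T) (t : ℝ) : clip T t ∈ Icc 0 T :=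
  ⟨le_max_left _ _, max_le hT (min_le_right _ _)⟩

lemma clip_of_mem {T t : ℝ} (ht : t ∈ Icc 0 T) : clip T t = t := by
  rw [clip, min_eq_left ht.2, max_eq_right ht.1]

lemma clip_of_le {T t : ℝ} (hT : 0 ≤ T) (ht : T ≤ t) : clip T t = T := by
  rw [clip, min_eq_right ht, max_eq_right hT]

lemma continuous_clip (T : ℝ) : Continuous (clip T) := by unfold clip; fun_prop

lemma abs_clip_sub_clip_le (T a b : ℝ) : |clip T a - clip T b| ≤ |a - b| :=
  (abs_max_sub_max_le_max _ _ _ _).trans (by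
    rw [sub_self, abs_zero, max_eq_right (abs_nonneg _)]
    refine (abs_min_sub_min_le_max _ _ _ _).trans ?_
    rw [sub_self, abs_zero, max_eq_left (abs_nonneg _)])

section Curve

variable {Ω : Type*} [MeasurableSpace Ω] {P : Measure Ω}

/-- The curve `t ↦ 1_{[0,t)}` in `𝔥`, stopped at time `T`; it corresponds to `t ↦ G_t`. -/
noncomputable def noiseCurve (G : CenteredGaussianProcess P) (T t : ℝ) : HSpace G T :=
  indH G T 0 (clip T t)

variable {G : CenteredGaussianProcess P} {T : ℝ}

lemma noiseCurve_clip (hT : 0 ≤ T) (t : ℝ) :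
    noiseCurve G T (clip T t) = noiseCurve G T t := by
  rw [noiseCurve, clip_of_mem (clip_mem hT t), noiseCurve]

lemma indH_eq_sub {a b : ℝ} (ha : 0 ≤ a) (hab : a ≤ b) (hb : b ≤ T) :
    indH G T a b = noiseCurve G T b - noiseCurve G T a := by
  rw [noiseCurve, noiseCurve, clip_of_mem ⟨ha.trans hab, hb⟩, clip_of_mem ⟨ha, hab.trans hb⟩,
    indH, indH, indH, ← UniformSpace.Completion.coe_sub]
  congr 1
  refine Subtype.ext (a1 := Step.ind G T a b) ?_
  change (Ico (max a 0) (min b T)).indicator (1 : ℝ → ℝ) =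
    (Ico (max 0 0) (min b T)).indicator 1 - (Ico (max 0 0) (min a T)).indicator 1
  rw [max_eq_left ha, max_self, min_eq_left hb, min_eq_left (hab.trans hb)]
  funext x
  simp only [indicator_apply, mem_Ico, Pi.one_apply, Pi.sub_apply]
  split_ifs <;> grind

lemma inner_noiseCurve_sub {a b c d : ℝ} (ha : 0 ≤ a) (hab : a ≤ b) (hb : b ≤ T) (hc : 0 ≤ c)
    (hcd : c ≤ d) (hd : d ≤ T) :
    inner ℝ (noiseCurve G T b - noiseCurve G T a) (noiseCurve G T d - noiseCurve G T c) =
      rectInc G.cov a b c d := by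
  have hi : ∀ t s, Integrable (fun ω => G.at t ω * G.at s ω) P := fun t s =>
    (G.memLp_at t).integrable_mul (G.memLp_at s)
  rw [← indH_eq_sub ha hab hb, ← indH_eq_sub hc hcd hd, inner_indH G T ha hab hb hc hcd hd]
  simp only [rectInc, CenteredGaussianProcess.cov]
  have h1 : Integrable (fun ω => G.at b ω * G.at d ω - G.at a ω * G.at d ω) P :=
    (hi b d).sub (hi a d)
  have h2 : Integrable
      (fun ω => G.at b ω * G.at d ω - G.at a ω * G.at d ω - G.at b ω * G.at c ω) P :=
    h1.sub (hi b c)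
  rw [← integral_sub (hi b d) (hi a d), ← integral_sub h1 (hi b c), ← integral_add h2 (hi a c)]
  refine integral_congr_ae (ae_of_all _ fun ω => ?_)
  ring

lemma norm_noiseCurve_sub_sq (hT : 0 ≤ T) (t s : ℝ) :
    ‖noiseCurve G T t - noiseCurve G T s‖ ^ 2 =
      rectInc G.cov (clip T s) (clip T t) (clip T s) (clip T t) := by
  wlog h : clip T s ≤ clip T t generalizing t s
  · rw [norm_sub_rev, this s t (le_of_not_ge h)]
    simp only [rectInc]
    ring
  rw [← noiseCurve_clip hT t, ← noiseCurve_clip hT s, ← real_inner_self_eq_norm_sq,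
    inner_noiseCurve_sub (clip_mem hT s).1 h (clip_mem hT t).2 (clip_mem hT s).1 h
      (clip_mem hT t).2]

lemma continuous_noiseCurve (hT : 0 ≤ T)
    (hG : ContinuousOn (Function.uncurry G.cov) (Ici 0 ×ˢ Ici 0)) :
    Continuous (noiseCurve G T) := by
  refine continuous_iff_continuousAt.2 fun s => tendsto_iff_norm_sub_tendsto_zero.2 ?_
  have hc : ∀ f g : ℝ → ℝ, Continuous f → Continuous g →
      Continuous fun t => G.cov (clip T (f t)) (clip T (g t)) := fun f g hf hg =>
    hG.comp_continuous (f := fun t => (clip T (f t), clip T (g t)))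
      (((continuous_clip T).comp hf).prodMk ((continuous_clip T).comp hg))
      fun t => ⟨(clip_mem hT _).1, (clip_mem hT _).1⟩
  have h1 : Continuous fun t => rectInc G.cov (clip T s) (clip T t) (clip T s) (clip T t) :=
    (((hc _ _ continuous_id continuous_id).sub (hc _ _ continuous_const continuous_id)).sub
      (hc _ _ continuous_id continuous_const)).add (hc _ _ continuous_const continuous_const)
  have h2 : Tendsto (fun t => ‖noiseCurve G T t - noiseCurve G T s‖ ^ 2) (𝓝 s) (𝓝 0) := by
    have h3 := h1.tendsto s
    simp only [← norm_noiseCurve_sub_sq hT] at h3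
    simpa using h3
  have h4 := (Real.continuous_sqrt.tendsto 0).comp h2
  simpa [Function.comp_def, Real.sqrt_sq] using h4

lemma exists_norm_noiseCurve_sub_lt (hT : 0 ≤ T) (hg : Continuous (noiseCurve G T)) {ε : ℝ}
    (hε : 0 < ε) : ∃ η > 0, ∀ a b, |a - b| < η → ‖noiseCurve G T a - noiseCurve G T b‖ < ε := by
  obtain ⟨η, hη, h⟩ := Metric.uniformContinuousOn_iff.1
    (isCompact_Icc.uniformContinuousOn_of_continuous hg.continuousOn (s := Icc 0 T)) ε hε
  refine ⟨η, hη, fun a b hab => ?_⟩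
  have := h (clip T a) (clip_mem hT a) (clip T b) (clip_mem hT b)
    (by rw [Real.dist_eq]; exact (abs_clip_sub_clip_le T a b).trans_lt hab)
  rwa [noiseCurve_clip hT, noiseCurve_clip hT, dist_eq_norm] at this

lemma exists_norm_noiseCurve_le (hT : 0 ≤ T) (hg : Continuous (noiseCurve G T)) :
    ∃ B, ∀ t, ‖noiseCurve G T t‖ ≤ B := by
  obtain ⟨B, hB⟩ := isCompact_Icc.exists_bound_of_continuousOn hg.continuousOn (s := Icc 0 T)
  exact ⟨B, fun t => by simpa only [noiseCurve_clip hT] using hB _ (clip_mem hT t)⟩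

/-! ### The backward Ornstein–Uhlenbeck curve -/

variable {θ : ℝ}

/-- The backward Ornstein–Uhlenbeck curve `X_r = ∫_r^T e^{-θ(t-r)} dG_t` in `𝔥`, written as the
mean increment of the noise after `r` over an exponential time (stopped at `T`). -/
noncomputable def backwardOU (G : CenteredGaussianProcess P) (θ T r : ℝ) : HSpace G T :=
  ∫ v, (noiseCurve G T (r + v) - noiseCurve G T r) ∂(expMeasure θ)

lemma integrable_noiseCurve_sub (hθ : 0 < θ) (hg : Continuous (noiseCurve G T))
    {B : ℝ} (hB : ∀ t, ‖noiseCurve G T t‖ ≤ B) (r : ℝ) :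
    Integrable (fun v => noiseCurve G T (r + v) - noiseCurve G T r) (expMeasure θ) := by
  have := isProbabilityMeasure_expMeasure hθ
  exact Integrable.of_bound (by fun_prop : Continuous _).aestronglyMeasurable (B + B)
    (ae_of_all _ fun v => (norm_sub_le _ _).trans (add_le_add (hB _) (hB _)))

lemma norm_backwardOU_le (hθ : 0 < θ) {B : ℝ} (hB : ∀ t, ‖noiseCurve G T t‖ ≤ B) (r : ℝ) :
    ‖backwardOU G θ T r‖ ≤ 2 * B := by
  have := isProbabilityMeasure_expMeasure hθ
  have h := norm_integral_le_of_norm_le_const (μ := expMeasure θ) (C := 2 * B)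
    (f := fun v => noiseCurve G T (r + v) - noiseCurve G T r)
    (ae_of_all _ fun v => (norm_sub_le _ _).trans (by linarith [hB (r + v), hB r]))
  simpa [backwardOU] using h

lemma continuous_backwardOU (hθ : 0 < θ) (hg : Continuous (noiseCurve G T))
    {B : ℝ} (hB : ∀ t, ‖noiseCurve G T t‖ ≤ B) : Continuous (backwardOU G θ T) := by
  have := isProbabilityMeasure_expMeasure hθ
  refine continuous_of_dominated (bound := fun _ => B + B)
    (fun r => (by fun_prop : Continuous _).aestronglyMeasurable)
    (fun r => ae_of_all _ fun v => (norm_sub_le _ _).trans (add_le_add (hB _) (hB _)))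
    (integrable_const _) (ae_of_all _ fun v => by fun_prop)

/-- A product bound on `⟨Y_u, Z_v⟩` passes to the inner product of the means. -/
lemma abs_inner_integral_le {E : Type*} [NormedAddCommGroup E] [InnerProductSpace ℝ E]
    [CompleteSpace E] {μ : Measure ℝ} {Y Z : ℝ → E} {φ : ℝ → ℝ} {c : ℝ} {S : Set ℝ}
    (hY : Integrable Y μ) (hZ : Integrable Z μ) (hφ : Integrable φ μ) (hS : ∀ᵐ u ∂μ, u ∈ S)
    (h : ∀ u ∈ S, ∀ v ∈ S, |inner ℝ (Y u) (Z v)| ≤ c * (φ u * φ v)) :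
    |inner ℝ (∫ u, Y u ∂μ) (∫ v, Z v ∂μ)| ≤ c * (∫ u, φ u ∂μ) ^ 2 := by
  have h1 : ∀ u ∈ S, |inner ℝ (Y u) (∫ v, Z v ∂μ)| ≤ c * (∫ u, φ u ∂μ) * φ u := by
    intro u hu
    rw [← integral_inner hZ]
    rw [← Real.norm_eq_abs]
    refine (norm_integral_le_of_norm_le (hφ.const_mul (c * φ u)) ?_).trans_eq ?_
    · filter_upwards [hS] with v hv
      rw [Real.norm_eq_abs, mul_assoc]
      exact h u hu v hv
    · rw [integral_const_mul]; ring
  rw [real_inner_comm, ← integral_inner hY, ← Real.norm_eq_abs]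
  refine (norm_integral_le_of_norm_le (hφ.const_mul (c * ∫ u, φ u ∂μ)) ?_).trans_eq ?_
  · filter_upwards [hS] with u hu
    rw [Real.norm_eq_abs, real_inner_comm]
    exact h1 u hu
  · rw [integral_const_mul]; ring

/-- The covariance of the backward Ornstein–Uhlenbeck curve. -/
lemma abs_inner_backwardOU_le {H C' : ℝ} (hθ : 0 < θ) (hT : 0 ≤ T) (hH : 0 < H) (hH' : H ≤ 1 / 2)
    (hC' : 0 ≤ C') (hG : NoiseHypothesis G.cov H C') {r s : ℝ} (hr : r ∈ Icc 0 T)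
    (hs : s ∈ Icc 0 T) :
    |inner ℝ (backwardOU G θ T r) (backwardOU G θ T s)| ≤
      (incConst H C' * (∫ v, (1 + v ^ 2) ∂(expMeasure θ)) ^ 2) *
        (decay H (r - s) + weight H r * weight H s) := by
  have hg := continuous_noiseCurve (G := G) hT hG.continuous
  obtain ⟨B, hB⟩ := exists_norm_noiseCurve_le hT hg
  have hk := incConst_nonneg (H := H) hC'
  have hw : 0 ≤ decay H (r - s) + weight H r * weight H s :=
    add_nonneg (decay_pos _ _).le (mul_nonneg (weight_pos _ _).le (weight_pos _ _).le)
  have hinc : ∀ r ∈ Icc 0 T, ∀ u, 0 ≤ u → r ≤ clip T (r + u) ∧ (clip T (r + u) - r) ^ 2 ≤ u ^ 2 := by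
    intro r hr u hu
    have h1 : r ≤ clip T (r + u) := by
      rw [clip]
      exact (le_min (by linarith) hr.2).trans (le_max_right _ _)
    have h2 : clip T (r + u) - r ≤ u := by
      have := (le_abs_self _).trans (abs_clip_sub_clip_le T (r + u) r)
      rw [clip_of_mem hr, add_sub_cancel_left, abs_of_nonneg hu] at this
      exact this
    exact ⟨h1, pow_le_pow_left₀ (sub_nonneg.2 h1) h2 2⟩
  refine (abs_inner_integral_le (c := incConst H C' * (decay H (r - s) + weight H r * weight H s))
    (φ := fun v => 1 + v ^ 2) (integrable_noiseCurve_sub hθ hg hB r)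
    (integrable_noiseCurve_sub hθ hg hB s) (integrable_one_add_sq_expMeasure hθ)
    (S := Ici 0) (ae_nonneg_expMeasure θ) fun u hu v hv => ?_).trans_eq (by ring)
  obtain ⟨a1, a2⟩ := hinc r hr u hu
  obtain ⟨b1, b2⟩ := hinc s hs v hv
  rw [← noiseCurve_clip hT (r + u), ← noiseCurve_clip hT (s + v),
    inner_noiseCurve_sub hr.1 a1 (clip_mem hT _).2 hs.1 b1 (clip_mem hT _).2]
  refine (hG.abs_rectInc_le G.cov_comm hH hH' hC' hr.1 a1 hs.1 b1).trans ?_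
  have e : (1 + |r - s|) ^ (2 * H - 2) + (1 + r) ^ (H - 1) * (1 + s) ^ (H - 1) =
      decay H (r - s) + weight H r * weight H s := by
    rw [decay, weight, weight, abs_of_nonneg hr.1, abs_of_nonneg hs.1]
  rw [e, mul_right_comm]
  gcongr

end Curve

/-! ### Convergence of the step functions -/

section Discretization

/-- The increments of a curve over the partition steps that start before `b` add up to its
increment over `[t₀, b]`, up to the oscillation of the curve over one step. -/
lemma norm_sum_increments_sub_le {E : Type*} [NormedAddCommGroup E] {γ : ℝ → E} {ε η b : ℝ}
    (hε : 0 ≤ ε) (hγ : ∀ x y, |x - y| < η → ‖γ x - γ y‖ ≤ ε) {t : ℕ → ℝ} (hb : t 0 ≤ b) (n : ℕ)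
    (ht : ∀ i < n, t i ≤ t (i + 1) ∧ t (i + 1) - t i < η) :
    (t n < b → ∑ i ∈ Finset.range n, (if t i < b then γ (t (i + 1)) - γ (t i) else 0) =
      γ (t n) - γ (t 0)) ∧
    (b ≤ t n → ‖∑ i ∈ Finset.range n, (if t i < b then γ (t (i + 1)) - γ (t i) else 0) -
      (γ b - γ (t 0))‖ ≤ ε) := by
  induction n with
  | zero =>
    refine ⟨fun _ => by simp, fun h => ?_⟩
    rw [le_antisymm hb h]
    simpa using hε
  | succ n ih =>
    obtain ⟨ih1, ih2⟩ := ih fun i hi => ht i (hi.trans n.lt_succ_self)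
    obtain ⟨h1, h2⟩ := ht n n.lt_succ_self
    rw [Finset.sum_range_succ]
    rcases lt_or_ge (t n) b with h | h
    · rw [if_pos h, ih1 h, add_comm (γ (t n) - γ (t 0)), sub_add_sub_cancel]
      refine ⟨fun _ => rfl, fun h3 => ?_⟩
      rw [sub_sub_sub_cancel_right]
      exact hγ _ _ (by rw [abs_of_nonneg (sub_nonneg.2 h3)]; linarith)
    · rw [if_neg (not_lt.2 h), add_zero]
      exact ⟨fun h3 => absurd h3 (not_lt.2 (h.trans h1)), fun _ => ih2 h⟩

lemma mem_Icc_of_partition {T : ℝ} {n : ℕ} {t : ℕ → ℝ} (h0 : t 0 = 0) (hn : t n = T)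
    (ht : ∀ i < n, t i ≤ t (i + 1)) {i : ℕ} (hi : i ≤ n) : t i ∈ Icc 0 T := by
  have hmono : ∀ i j, i ≤ j → j ≤ n → t i ≤ t j := fun i j hij => by
    induction j, hij using Nat.le_induction with
    | base => exact fun _ => le_rfl
    | succ j _ ih => exact fun hj => (ih (by omega)).trans (ht j (by omega))
  exact ⟨h0 ▸ hmono 0 i i.zero_le hi, hn ▸ hmono i n hi le_rfl⟩

end Discretization

section Represents

variable {Ω : Type*} [MeasurableSpace Ω] {P : Measure Ω} {G : CenteredGaussianProcess P}
  {θ T : ℝ}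

/-- The exponential kernel `e^{-θ(t-r)}` on `r ≤ t`. -/
noncomputable def expKernel (θ r t : ℝ) : ℝ := if r ≤ t then Real.exp (-θ * (t - r)) else 0

lemma abs_expKernel_le_one (hθ : 0 ≤ θ) (r t : ℝ) : |expKernel θ r t| ≤ 1 := by
  unfold expKernel
  split_ifs with h
  · rw [abs_of_pos (Real.exp_pos _), Real.exp_le_one_iff]
    nlinarith
  · simp

lemma measurable_expKernel (θ t : ℝ) : Measurable fun r => expKernel θ r t :=
  Measurable.ite measurableSet_Iic (by fun_prop) measurable_const

lemma integral_ite_expMeasure (hθ : 0 < θ) {E : Type*} [NormedAddCommGroup E] [NormedSpace ℝ E]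
    [CompleteSpace E] (r t : ℝ) (x : E) :
    ∫ v, (if r ≤ t ∧ t < r + v then x else 0) ∂(expMeasure θ) = expKernel θ r t • x := by
  unfold expKernel
  by_cases h : r ≤ t
  · have e : (fun v => if r ≤ t ∧ t < r + v then x else 0) =
        (Ioi (t - r)).indicator fun _ => x := by
      funext v
      simp only [indicator_apply, mem_Ioi, h, true_and, sub_lt_iff_lt_add']
    rw [e, integral_indicator_const x measurableSet_Ioi, if_pos h,
      expMeasure_real_Ioi hθ (sub_nonneg.2 h)]
  · simp [h]

/-- The discretized backward Ornstein–Uhlenbeck curve. -/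
noncomputable def discreteOU (G : CenteredGaussianProcess P) (θ T : ℝ) (n : ℕ) (t : ℕ → ℝ)
    (r : ℝ) : HSpace G T :=
  ∑ i ∈ Finset.range n, expKernel θ r (t i) • (noiseCurve G T (t (i + 1)) - noiseCurve G T (t i))

lemma htmul_sum_smul {E ι : Type*} [NormedAddCommGroup E] [InnerProductSpace ℝ E] (s : Finset ι)
    (c : ι → ℝ) (x : ι → E) : htmul (∑ i ∈ s, c i • x i) (∑ i ∈ s, c i • x i) =
      ∑ i ∈ s, ∑ j ∈ s, (c i * c j) • htmul (x i) (x j) := by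
  have hcoe : ∀ z : TensorProduct ℝ E E, (z : UniformSpace.Completion (TensorProduct ℝ E E)) =
    (UniformSpace.Completion.toComplL (𝕜 := ℝ) (E := TensorProduct ℝ E E)) z := fun z => rfl
  simp only [htmul, hcoe, TensorProduct.sum_tmul, TensorProduct.tmul_sum, map_sum,
    TensorProduct.smul_tmul_smul, map_smul]
  exact Finset.sum_comm

/-- The step function approximating `f_T` is a mixture of squares of discretized curves. -/
lemma discretize_eq_integral (hθ : 0 < θ) {n : ℕ} {t : ℕ → ℝ}
    (ht : ∀ i ≤ n, t i ∈ Icc 0 T) (hmono : ∀ i < n, t i ≤ t (i + 1)) :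
    discretize G T (fKernel θ T) n t =
      ∫ r, htmul (discreteOU G θ T n t r) (discreteOU G θ T n t r) ∂(mixMeasure θ T) := by
  have hint : ∀ (i j : ℕ), Integrable (fun r => expKernel θ r (t i) * expKernel θ r (t j))
      (mixMeasure θ T) := fun i j =>
    Integrable.of_bound
      ((measurable_expKernel θ _).mul (measurable_expKernel θ _)).aestronglyMeasurable 1
      (ae_of_all _ fun r => by
        rw [Real.norm_eq_abs, abs_mul]
        exact mul_le_one₀ (abs_expKernel_le_one hθ.le _ _) (abs_nonneg _)
          (abs_expKernel_le_one hθ.le _ _))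
  simp only [discreteOU, htmul_sum_smul]
  rw [integral_finsetSum _ fun i _ => integrable_finsetSum _ fun j _ => (hint i j).smul_const _]
  refine Finset.sum_congr rfl fun i hi => ?_
  rw [integral_finsetSum _ fun j _ => (hint i j).smul_const _]
  refine Finset.sum_congr rfl fun j hj => ?_
  have hi := Finset.mem_range.1 hi
  have hj := Finset.mem_range.1 hj
  have hi' := ht i hi.le
  have hj' := ht j hj.le
  rw [integral_smul_const, indH_eq_sub hi'.1 (hmono i hi) (ht (i + 1) hi).2,
    indH_eq_sub hj'.1 (hmono j hj) (ht (j + 1) hj).2, fKernel, if_pos ⟨hi', hj'⟩,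
    ← integral_mixMeasure_exp hθ hi' hj']
  rfl

/-- The discretized curve is the mean of the increments of the noise over the partition steps that
start in `[r, r + v)`, which are close to the increment over `[r, r + v]`. -/
lemma norm_discreteOU_sub_le (hθ : 0 < θ) (hT : 0 ≤ T) (hg : Continuous (noiseCurve G T))
    {ε η : ℝ} (hε : 0 ≤ ε)
    (hη : ∀ x y, |x - y| < η → ‖noiseCurve G T x - noiseCurve G T y‖ ≤ ε) {n : ℕ} {t : ℕ → ℝ}
    (h0 : t 0 = 0) (hn : t n = T) (ht : ∀ i < n, t i ≤ t (i + 1) ∧ t (i + 1) - t i < η) {r : ℝ}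
    (hr : 0 ≤ r) : ‖discreteOU G θ T n t r - backwardOU G θ T r‖ ≤ 2 * ε := by
  have := isProbabilityMeasure_expMeasure hθ
  obtain ⟨B, hB⟩ := exists_norm_noiseCurve_le hT hg
  set γ := noiseCurve G T with hγ
  have key : ∀ b, 0 ≤ b → ‖∑ i ∈ Finset.range n, (if t i < b then γ (t (i + 1)) - γ (t i) else 0) -
      (γ b - γ 0)‖ ≤ ε := by
    intro b hb
    obtain ⟨h1, h2⟩ := norm_sum_increments_sub_le hε hη (h0.le.trans hb) n ht
    rw [hn, h0] at h1 h2
    rcases lt_or_ge T b with h | h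
    · rw [h1 h, hγ, ← noiseCurve_clip hT b, clip_of_le hT h.le, sub_self, norm_zero]
      exact hε
    · exact h2 h
  have hm : ∀ i, Integrable (fun v => if r ≤ t i ∧ t i < r + v then γ (t (i + 1)) - γ (t i) else 0)
      (expMeasure θ) := fun i => by
    refine Integrable.of_bound (StronglyMeasurable.ite ?_ stronglyMeasurable_const
      stronglyMeasurable_const).aestronglyMeasurable ‖γ (t (i + 1)) - γ (t i)‖
      (ae_of_all _ fun v => ?_)
    · exact MeasurableSet.inter (MeasurableSet.const _)
        (measurableSet_lt measurable_const (measurable_const.add measurable_id))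
    · split_ifs
      · exact le_rfl
      · simp
  have e : discreteOU G θ T n t r = ∫ v, ∑ i ∈ Finset.range n,
      (if r ≤ t i ∧ t i < r + v then γ (t (i + 1)) - γ (t i) else 0) ∂(expMeasure θ) := by
    rw [integral_finsetSum _ fun i _ => hm i, discreteOU]
    exact Finset.sum_congr rfl fun i _ => (integral_ite_expMeasure hθ _ _ _).symm
  rw [e, backwardOU, ← integral_sub (integrable_finsetSum _ fun i _ => hm i)
    (integrable_noiseCurve_sub hθ hg hB r)]
  have h := norm_integral_le_of_norm_le_const (μ := expMeasure θ) (C := 2 * ε)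
    (f := fun v => ∑ i ∈ Finset.range n,
      (if r ≤ t i ∧ t i < r + v then γ (t (i + 1)) - γ (t i) else 0) - (γ (r + v) - γ r)) (by
    filter_upwards [ae_nonneg_expMeasure θ] with v hv
    have h1 := key (r + v) (by linarith)
    have h2 := key r hr
    have e2 : ∑ i ∈ Finset.range n,
        (if r ≤ t i ∧ t i < r + v then γ (t (i + 1)) - γ (t i) else 0) - (γ (r + v) - γ r) =
        (∑ i ∈ Finset.range n, (if t i < r + v then γ (t (i + 1)) - γ (t i) else 0) -
          (γ (r + v) - γ 0)) -
        (∑ i ∈ Finset.range n, (if t i < r then γ (t (i + 1)) - γ (t i) else 0) -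
          (γ r - γ 0)) := by
      rw [sub_sub_sub_comm, ← Finset.sum_sub_distrib, sub_sub_sub_cancel_right]
      congr 1
      refine Finset.sum_congr rfl fun i _ => ?_
      by_cases c1 : r ≤ t i
      · simp [c1, not_lt.2 c1]
      · have c2 : t i < r := not_le.1 c1
        simp [c1, c2, show t i < r + v by linarith]
    rw [e2]
    exact (norm_sub_le _ _).trans (by linarith))
  simpa using h

/-- The limit of the step functions attached to `f_T` is `∫ X_r ⊗ X_r dν(r)`. -/
lemma represents_fKernel (hθ : 0 < θ) (hT : 0 ≤ T) (hg : Continuous (noiseCurve G T)) :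
    Represents G T (fKernel θ T)
      (∫ r, htmul (backwardOU G θ T r) (backwardOU G θ T r) ∂(mixMeasure θ T)) := by
  intro ε hε
  obtain ⟨B, hB⟩ := exists_norm_noiseCurve_le hT hg
  have hB0 : 0 ≤ B := (norm_nonneg _).trans (hB 0)
  set N := (mixMeasure θ T).real univ with hN
  have hN0 : 0 ≤ N := measureReal_nonneg
  set κ := min 1 (ε / (2 * (4 * B + 2) * (N + 1))) with hκ
  have hκ0 : 0 < κ := lt_min one_pos (by positivity)
  obtain ⟨η, hη, hγ⟩ := exists_norm_noiseCurve_sub_lt hT hg hκ0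
  refine ⟨η, hη, fun n t h0 hn ht => ?_⟩
  have hmono : ∀ i < n, t i ≤ t (i + 1) := fun i hi => (ht i hi).1
  rw [discretize_eq_integral hθ (fun i hi => mem_Icc_of_partition h0 hn hmono hi) hmono]
  have hX := (continuous_backwardOU hθ hg hB).stronglyMeasurable
  have hXB := norm_backwardOU_le hθ hB
  have hm : StronglyMeasurable (discreteOU G θ T n t) := by
    refine Finset.stronglyMeasurable_fun_sum _ fun i _ => ?_
    exact (measurable_expKernel θ _).stronglyMeasurable.smul stronglyMeasurable_const
  have hdB : ∀ r, ‖discreteOU G θ T n t r‖ ≤ ∑ i ∈ Finset.range n,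
      ‖noiseCurve G T (t (i + 1)) - noiseCurve G T (t i)‖ := fun r => by
    refine (norm_sum_le _ _).trans (Finset.sum_le_sum fun i _ => ?_)
    rw [norm_smul]
    exact mul_le_of_le_one_left (norm_nonneg _) (abs_expKernel_le_one hθ.le _ _)
  rw [← integral_sub (integrable_htmul hm hm hdB hdB) (integrable_htmul hX hX hXB hXB)]
  have h1 : ∀ᵐ r ∂(mixMeasure θ T), ‖htmul (discreteOU G θ T n t r) (discreteOU G θ T n t r) -
      htmul (backwardOU G θ T r) (backwardOU G θ T r)‖ ≤ 2 * κ * (4 * B + 2) := by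
    filter_upwards [ae_mem_mixMeasure hT] with r hr
    have h2 := norm_discreteOU_sub_le hθ hT hg hκ0.le (fun x y h => (hγ x y h).le) h0 hn ht hr.1
    have h3 := hXB r
    have h4 : ‖discreteOU G θ T n t r‖ ≤ 2 * B + 2 := by
      have := norm_le_norm_add_norm_sub' (discreteOU G θ T n t r) (backwardOU G θ T r)
      linarith [min_le_left 1 (ε / (2 * (4 * B + 2) * (N + 1)))]
    rw [htmul_sub_htmul]
    refine (norm_add_le _ _).trans ?_
    rw [norm_htmul, norm_htmul]
    calc _ ≤ 2 * κ * (2 * B + 2) + 2 * B * (2 * κ) := by gcongr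
      _ = _ := by ring
  refine (norm_integral_le_of_norm_le_const h1).trans_lt ?_
  have h2 : κ * (2 * (4 * B + 2) * (N + 1)) ≤ ε := by
    rw [← le_div_iff₀ (by positivity)]
    exact min_le_right _ _
  have h3 : 0 < κ * (2 * (4 * B + 2)) := by positivity
  rw [← hN]
  nlinarith

end Represents

/-! ### Growth of the contraction -/

/-- The norm of `f_T ⊗₁ f_T` is at most of order `√T`, for every `H < 1/2`. -/
lemma exists_norm_contraction_le {H θ C' : ℝ} (hH0 : 0 < H) (hH : H < 1 / 2) (hθ : 0 < θ)
    (hC' : 0 ≤ C') : ∃ k : ℝ, 0 ≤ k ∧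
      ∀ {Ω : Type*} [MeasurableSpace Ω] {P : Measure Ω} (G : CenteredGaussianProcess P),
        NoiseHypothesis G.cov H C' → ∀ T : ℝ, 1 ≤ T →
          ∃ F : HTensor (HSpace G T), Represents G T (fKernel θ T) F ∧
            ∀ (ι : Type) (e : HilbertBasis ι ℝ (HSpace G T)),
              ‖contraction e F F‖ ≤ k * Real.sqrt T := by
  set A := incConst H C' * (∫ v, (1 + v ^ 2) ∂(expMeasure θ)) ^ 2 with hA
  have hA0 : 0 ≤ A := mul_nonneg (incConst_nonneg hC') (sq_nonneg _)
  set J := 1 + 2 * θ * ∫ x, decay H x with hJ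
  have hJ0 : 0 ≤ J := by
    have := integral_nonneg (μ := volume) (f := decay H) fun x => (decay_pos H x).le
    positivity
  refine ⟨Real.sqrt (576 * A ^ 4 * J ^ 3 * (1 + 2 * θ)), Real.sqrt_nonneg _, ?_⟩
  intro Ω _ P G hG T hT
  have hT0 : 0 ≤ T := zero_le_one.trans hT
  have hg := continuous_noiseCurve (G := G) hT0 hG.continuous
  obtain ⟨B, hB⟩ := exists_norm_noiseCurve_le hT0 hg
  refine ⟨_, represents_fKernel hθ hT0 hg, fun ι e => ?_⟩
  rw [← Real.sqrt_mul (by positivity)]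
  refine Real.le_sqrt_of_sq_le ?_
  rw [norm_sq_contraction_integral_htmul e (continuous_backwardOU hθ hg hB).stronglyMeasurable
    (norm_backwardOU_le hθ hB)]
  refine (integral_integral_sq_le hH0.le (by linarith)
    (integral_decay_mixMeasure_le (T := T) hθ.le hH) hA0 (ae_mem_mixMeasure hT0)
    (K := fun r s => inner ℝ (backwardOU G θ T r) (backwardOU G θ T s))
    fun r hr s hs => abs_inner_backwardOU_le hθ hT0 hH0 hH.le hC' hG hr hs).trans ?_
  rw [mul_assoc _ (1 + 2 * θ) T]
  exact mul_le_mul_of_nonneg_left (mixMeasure_real_univ_le hθ.le hT) (by positivity)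

lemma deltaExp_le (H : ℝ) : deltaExp H ≤ 1 / 2 := by
  unfold deltaExp
  split_ifs with h
  · exact le_rfl
  · linarith [not_lt.1 h]

end GaussianOU

theorem proposition4p1 (H θ C' : ℝ) (hH0 : 0 < H) (hH1 : H < 3 / 8) (hθ : 0 < θ) (hC' : 0 ≤ C') :
    ∃ C : ℝ, 0 < C ∧
      ∀ (Ω : Type u) [MeasurableSpace Ω] (P : MeasureTheory.Measure Ω)
        [MeasureTheory.IsProbabilityMeasure P] (G : CenteredGaussianProcess P),
        NoiseHypothesis G.cov H C' →
        ∀ T : ℝ, 1 ≤ T →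
          ∃ F : HTensor (HSpace G T), Represents G T (fKernel θ T) F ∧
            ∀ (ι : Type) (e : HilbertBasis ι ℝ (HSpace G T)),
              (H ≠ 1 / 4 → (1 / T) * ‖contraction e F F‖ ≤ C / T ^ deltaExp H) ∧
              (H = 1 / 4 → 2 ≤ T →
                (1 / T) * ‖contraction e F F‖ ≤ C * (Real.log T / Real.sqrt T)) := by
  obtain ⟨k, hk, h⟩ := exists_norm_contraction_le.{u} hH0 (by linarith) hθ hC'
  refine ⟨2 * k + 1, by linarith, fun Ω _ P _ G hG T hT => ?_⟩
  obtain ⟨F, hF, hFn⟩ := h G hG T hT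
  have hT0 : 0 < T := by linarith
  have hs : 0 < Real.sqrt T := Real.sqrt_pos.2 hT0
  have key : ∀ (ι : Type) (e : HilbertBasis ι ℝ (HSpace G T)),
      (1 / T) * ‖contraction e F F‖ ≤ k / Real.sqrt T := by
    intro ι e
    rw [le_div_iff₀ hs, div_mul_eq_mul_div, one_mul, div_mul_eq_mul_div, div_le_iff₀ hT0]
    calc ‖contraction e F F‖ * Real.sqrt T ≤ k * Real.sqrt T * Real.sqrt T :=
          mul_le_mul_of_nonneg_right (hFn ι e) hs.le
      _ = k * T := by rw [mul_assoc, Real.mul_self_sqrt hT0.le]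
  refine ⟨F, hF, fun ι e => ⟨fun _ => (key ι e).trans ?_, fun _ hT2 => (key ι e).trans ?_⟩⟩
  · rw [Real.sqrt_eq_rpow]
    have h1 : T ^ deltaExp H ≤ T ^ (1 / 2 : ℝ) :=
      Real.rpow_le_rpow_of_exponent_le hT (deltaExp_le H)
    have h2 : 0 < T ^ deltaExp H := Real.rpow_pos_of_pos hT0 _
    gcongr
    linarith
  · rw [← mul_div_assoc]
    have h1 : Real.log 2 ≤ Real.log T := Real.log_le_log two_pos hT2
    have h2 := Real.log_two_gt_d9
    gcongr
    nlinarith
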